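/- **Setting.** Let $X\subset\mathbb R^d$, $d\in\{2,3\}$, be a bounded domain and $\Omega$ the unit sphere of $\mathbb R^d$ with surface measure $\sigma$. Let $\sigma_t,\sigma_s\in L^\infty(X)$ with $\sigma_s\ge 0$ and $\sigma_t-\sigma_s\ge c_0$ a.e. in $X$ for a constant $c_0>0$. Let $g\colon X\times[-1,1]\to[0,\infty)$ be a phase function, measurable in its first variable, with $\int_\Omega g(x,\omega\cdot\hat\omega)\,d\sigma(\hat\omega)=1$ for all $x\in X$, $\omega\in\Omega$. Let $w_l>0$ and $\omega_l\in\Omega$, $0\le l\le L$, be the weights and nodes of a quadrature rule on $\Omega$ which is accurate enough that, with $m(x)=\max_{0\le l\le L}\sum_{i=0}^L w_i\,g(x,\omega_l\cdot\omega_i)$, there is a constant $c_0'>0$ such that $\sigma_t-m\,\sigma_s\ge c_0'$ a.e. in $X$. Let $\bar c>0$. **Meshes.** A mesh $T_h$ of $X$ is a finite partition of $X$ into convex polygons ($d=2$) or convex polyhedra ($d=3$): the interiors of the elements are pairwise disjoint and contained in $X$, and the closed elements cover $X$. Its mesh size $h$ is the largest diameter of an element, and $\delta=\bar c\,h$. For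 a positive integer $k$, let $V_h^l=\{v\in L^2(X): v|_K\in P_k(K)\ \forall K\in T_h\}$ with $P_k(K)$ the polynomials on $K$ of total degree at most $k$, and $\boldsymbol V_h=\prod_{l=0}^L V_h^l$. For $K\in T_h$ with unit outward normal $n$, let $\partial_-^lK=\{x\in\partial K:\omega_l\cdot n(x)<0\}$. On $\partial^l_-K$ let $v_+$ be the trace of $v$ from $K$, let $v_-$ be the trace from the adjacent element at points inside $X$ and $v_-=0$ at points of $\partial X$, and let $[v]=v_+-v_-$. Let $(\cdot,\cdot)_K$ and $\langle\cdot,\cdot\rangle_{\partial_-^lK}$ be the $L^2$ inner products on $K$ and, with respect to surface measure, on $\partial_-^lK$. **Theorem.** There is $h_0>0$, depending only on $d,X,\sigma_t,\sigma_s,g$, the quadrature rule, $c_0,c_0'$ and $\bar c$, such that for every mesh $T_h$ of $X$ with $h<h_0$, every integer $k\ge1$ and every source $f$ on $X\times\Omega$ with $f_l:=f(\cdot,\omega_l)\in L^2(X)$ for $0\le l\le L$, there is exactly one $\{u_h^l\}\in\boldsymbol V_h$ such that, for all $\{v_h^l\}\in\boldsymbol V_h$, $$\sum_{l=0}^Lw_l\sum_{K\in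 T_h}\bigl(\omega_l\cdot\nabla u_h^l+\sigma_tu_h^l,\;v_h^l+\delta\,\omega_l\cdot\nabla v_h^l\bigr)_K+\sum_{l=0}^Lw_l\sum_{K\in T_h}\bigl\langle[u_h^l],\;v^l_+\,|\omega_l\cdot n|\bigr\rangle_{\partial_-^lK}$$ $$=\sum_{l=0}^Lw_l\sum_{K\in T_h}\Bigl(\sigma_s\sum_{i=0}^Lw_i\,g(\cdot,\omega_l\cdot\omega_i)\,u_h^i+f_l,\;v_h^l+\delta\,\omega_l\cdot\nabla v_h^l\Bigr)_K .$$ -/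

import Mathlib

open MeasureTheory Set Filter Topology
open scoped BigOperators RealInnerProductSpace

namespace DODSD

/-- The physical space `ℝ^d` with its Euclidean norm. -/
abbrev Space (d : ℕ) : Type := EuclideanSpace ℝ (Fin d)

/-- The angular space `Ω`: the unit circle (`d = 2`) or the unit sphere (`d = 3`). -/
abbrev Angle (d : ℕ) : Type := Metric.sphere (0 : Space d) 1

/-- `K` is (the interior of) a convex polytope: a nonempty bounded set cut out by finitely many
strict linear inequalities. Triangles, convex quadrilaterals, tetrahedra, parallelepipeds and
prisms are of this form. -/
def IsConvexPolytope {d : ℕ} (K : Set (Space d)) : Prop :=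
  K.Nonempty ∧ Bornology.IsBounded K ∧
    ∃ H : Finset (Space d × ℝ), K = {x | ∀ p ∈ H, ⟪p.1, x⟫ < p.2}

/-- A finite element partition of `X`. Elements are represented by their interiors; they are
pairwise disjoint convex polytopes inside `X` whose closures cover `X`. Neither shape regularity
nor face-to-face conformity is required. -/
structure Mesh {d : ℕ} (X : Set (Space d)) where
  /-- the elements -/
  elements : Finset (Set (Space d))
  isConvexPolytope : ∀ K ∈ elements, IsConvexPolytope K
  subset_domain : ∀ K ∈ elements, K ⊆ X
  disjoint : ∀ K ∈ elements, ∀ K' ∈ elements, K ≠ K' → Disjoint K K'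
  cover : X ⊆ ⋃ K ∈ elements, closure K

/-- The mesh size `h`: the largest diameter of an element. -/
noncomputable def Mesh.size {d : ℕ} {X : Set (Space d)} (T : Mesh X) : ℝ :=
  ⨆ K : T.elements, Metric.diam (K : Set (Space d))

/-- `n` is the unit outward normal of the open polytope `K` at the boundary point `x`: near `x`,
the set `K` is the half space on the inner side of the hyperplane through `x` orthogonal to `n`. -/
def IsOuterNormal {d : ℕ} (K : Set (Space d)) (x n : Space d) : Prop :=
  ‖n‖ = 1 ∧ ∀ᶠ y in 𝓝 x, (y ∈ K ↔ ⟪n, y - x⟫ < 0)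

/-- The outward normal at a boundary point is unique. -/
theorem IsOuterNormal.unique {d : ℕ} {K : Set (Space d)} {x n m : Space d}
    (hn : IsOuterNormal K x n) (hm : IsOuterNormal K x m) : n = m := by
  by_contra hne
  have h1 : ⟪n, m⟫ < 1 := (inner_lt_one_iff_real_of_norm_eq_one hn.1 hm.1).2 hne
  have ht : Tendsto (fun t : ℝ => x + t • (m - n)) (𝓝[>] 0) (𝓝 x) := by
    have : Continuous (fun t : ℝ => x + t • (m - n)) := by fun_prop
    have h := this.tendsto 0
    simp only [zero_smul, add_zero] at h
    exact h.mono_left nhdsWithin_le_nhds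
  have hpos : ∀ᶠ t : ℝ in 𝓝[>] 0, 0 < t := self_mem_nhdsWithin
  obtain ⟨t, h2, h3, h4⟩ := ((ht.eventually hn.2).and ((ht.eventually hm.2).and hpos)).exists
  have hnn : ⟪n, n⟫ = 1 := by rw [real_inner_self_eq_norm_sq, hn.1]; norm_num
  have hmm : ⟪m, m⟫ = 1 := by rw [real_inner_self_eq_norm_sq, hm.1]; norm_num
  have hmn : ⟪m, n⟫ = ⟪n, m⟫ := real_inner_comm _ _
  rw [add_sub_cancel_left, inner_smul_right, inner_sub_right, hnn] at h2
  rw [add_sub_cancel_left, inner_smul_right, inner_sub_right, hmm, hmn] at h3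
  have h5 : t * (⟪n, m⟫ - 1) < 0 := mul_neg_of_pos_of_neg h4 (by linarith)
  have h6 := h3.1 (h2.2 h5)
  have h7 : 0 < t * (1 - ⟪n, m⟫) := mul_pos h4 (by linarith)
  linarith

open Classical in
/-- The unit outward normal `n_K(x)`; it is set to `0` where no normal exists (in the interior and
exterior of `K`, and on the edges and vertices, a set of zero surface measure). -/
noncomputable def outerNormal {d : ℕ} (K : Set (Space d)) (x : Space d) : Space d :=
  if h : ∃ n, IsOuterNormal K x n then h.choose else 0

/-- The incoming boundary `∂_- K = {x ∈ ∂K : ω · n(x) < 0}` for the direction `ω`. -/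
def inflowBoundary {d : ℕ} (ω : Space d) (K : Set (Space d)) : Set (Space d) :=
  {x | x ∈ frontier K ∧ ⟪ω, outerNormal K x⟫ < 0}

/-- The surface measure on hypersurfaces of `ℝ^d`: the `(d-1)`-dimensional Hausdorff measure,
normalized to agree with `(d-1)`-dimensional Lebesgue measure on hyperplanes. -/
noncomputable def surfaceMeasure (d : ℕ) : Measure (Space d) :=
  Measure.euclideanHausdorffMeasure (d - 1)

/-- The scalar space `V_h^l`: an arbitrary polynomial of total degree at most `k` on each element,
with no continuity between elements. -/
abbrev ScalarSpace {d : ℕ} {X : Set (Space d)} (T : Mesh X) (k : ℕ) : Type :=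
  T.elements → MvPolynomial.restrictTotalDegree (Fin d) ℝ k

/-- The space `V_h = ∏_{l=0}^{L} V_h^l`. -/
abbrev VecSpace {d : ℕ} {X : Set (Space d)} (T : Mesh X) (k L : ℕ) : Type :=
  Fin (L + 1) → ScalarSpace T k

/-- The value at `x` of the polynomial `v|_K`. At a boundary point of `K` it is the trace of `v`
from within `K`. -/
noncomputable def val {d : ℕ} {X : Set (Space d)} {T : Mesh X} {k : ℕ}
    (v : ScalarSpace T k) (K : T.elements) (x : Space d) : ℝ :=
  MvPolynomial.eval (fun i => x i) (v K : MvPolynomial (Fin d) ℝ)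

/-- The directional derivative `ω · ∇ (v|_K)` at `x`. -/
noncomputable def dirDeriv {d : ℕ} {X : Set (Space d)} {T : Mesh X} {k : ℕ}
    (ω : Space d) (v : ScalarSpace T k) (K : T.elements) (x : Space d) : ℝ :=
  ∑ j, ω j * MvPolynomial.eval (fun i => x i)
    (MvPolynomial.pderiv j (v K : MvPolynomial (Fin d) ℝ))

open Classical in
/-- The upstream trace `u_-` at a point `x` of the incoming boundary of `K`: zero if `x ∈ ∂X`,
and otherwise the value at `x` from the adjacent element `K' ≠ K`. (Away from edges and vertices
there is exactly one such `K'`, so that the sum has a single nonzero term.) -/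
noncomputable def upstream {d : ℕ} {X : Set (Space d)} {T : Mesh X} {k : ℕ}
    (u : ScalarSpace T k) (K : T.elements) (x : Space d) : ℝ :=
  if x ∈ frontier X then 0
  else ∑ K' : T.elements, if K' ≠ K ∧ x ∈ closure (K' : Set (Space d)) then val u K' x else 0

/-- The jump `[u] = u_+ - u_-` on the incoming boundary of `K`; there `u_+` is the trace of `u`
from within `K`, because `ω` points into `K`. -/
noncomputable def jump {d : ℕ} {X : Set (Space d)} {T : Mesh X} {k : ℕ}
    (u : ScalarSpace T k) (K : T.elements) (x : Space d) : ℝ :=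
  val u K x - upstream u K x

/-- `m(x) = max_l ∑_i w_i g(x, ω_l · ω_i)`. -/
noncomputable def quadMax {d L : ℕ} (g : Space d → ℝ → ℝ) (w : Fin (L + 1) → ℝ)
    (ω : Fin (L + 1) → Angle d) (x : Space d) : ℝ :=
  ⨆ l, ∑ i, w i * g x ⟪(ω l : Space d), (ω i : Space d)⟫

/-- `u` solves the global discrete-ordinate discontinuous-streamline diffusion system with total
cross section `σt`, scattering cross section `σs`, phase function `g`, source `f`, quadrature
weights `w` and directions `ω`, and diffusion parameter `δ`, on the mesh `T` with polynomials of
degree at most `k`. -/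
def IsSolution {d L k : ℕ} {X : Set (Space d)} (T : Mesh X) (σt σs : Space d → ℝ)
    (g : Space d → ℝ → ℝ) (f : Space d → Angle d → ℝ) (w : Fin (L + 1) → ℝ)
    (ω : Fin (L + 1) → Angle d) (δ : ℝ) (u : VecSpace T k L) : Prop :=
  ∀ v : VecSpace T k L,
    (∑ l, w l * ∑ K : T.elements, ∫ x in (K : Set (Space d)),
        (dirDeriv (ω l) (u l) K x + σt x * val (u l) K x) *
          (val (v l) K x + δ * dirDeriv (ω l) (v l) K x))
    + (∑ l, w l * ∑ K : T.elements, ∫ x in inflowBoundary (ω l : Space d) (K : Set (Space d)),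
        jump (u l) K x * (val (v l) K x * |⟪(ω l : Space d), outerNormal (K : Set (Space d)) x⟫|)
          ∂(surfaceMeasure d))
    = ∑ l, w l * ∑ K : T.elements, ∫ x in (K : Set (Space d)),
        (σs x * (∑ i, w i * g x ⟪(ω l : Space d), (ω i : Space d)⟫ * val (u i) K x) + f x (ω l)) *
          (val (v l) K x + δ * dirDeriv (ω l) (v l) K x)

end DODSD

/-!
The system is a square linear system on the finite-dimensional space `V_h`, so it is enough that its
bilinear form `b`, with the scattering term moved to the left, satisfies `b(u, u) > 0` for `u ≠ 0`
(`existsUnique_of_definite`, `bilinearForm_self_ge`, `eq_zero_of_integral_sq_nonpos`).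

For one direction `ω`, the terms `∑_K (ω · ∇u, u)_K + ∑_K ⟨[u], u_+ |ω · n|⟩` are nonnegative
(`transport_energy_nonneg`). The usual argument applies the divergence theorem on every element and
matches the faces of neighbouring elements. Here everything is instead disintegrated along the lines
in direction `ω`, which are parametrized by the hyperplane `ω^⊥`:

* by Fubini and the fundamental theorem of calculus, `(ω · ∇u, u)_K` is the integral over the lines
  of half the difference of `u²` between the exit point and the entry point of the line in `K`
  (`setIntegral_dirDeriv_mul_val`);
* the projection along `ω` turns `|ω · n| dS` on a hyperplane into Lebesgue measure on `ω^⊥`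
  (`map_lift_volume`), so integrals over `∂_- K` against `|ω · n| dS` are integrals over the lines
  of the values at the entry points (`setIntegral_inflowBoundary`);
* almost every line avoids the edges and vertices of all elements (`ae_isGeneric`), and on such a
  line the upstream value at the entry point of `K` is zero or the value at the exit point of the
  one element from which the line comes (`eventually_mem_neighbor`). The integrand is then at least
  half a sum of squares (`line_energy_nonneg`). Faces need not match, and the elements need not
  cover the domain.

The remaining terms are estimated pointwise (`pointwise_coercive`). By symmetry of
`g(x, ω_l · ω_i)` the scattering term is at most `m σ_s ∑ w_l |u^l|²`, which leaves
`c₀' ∑ w_l |u^l|²`. As `m σ_s ≤ σ_t ≤ M := ‖σ_t‖_∞`, the terms carrying `δ` are at least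
`-2 M² δ ∑ w_l |u^l|²`, by Young's inequality with part of the streamline term
`δ ∑ w_l |ω_l · ∇u^l|²`; they are absorbed if `4 M² δ ≤ c₀'`.
-/

namespace DODSD

/-! ### Lines in a fixed direction and projected surface measure -/

section

/-- The hyperplane through the origin orthogonal to `ω`; it parametrizes the lines in direction
`ω`. -/
noncomputable abbrev Perp {d : ℕ} (ω : Space d) : Submodule ℝ (Space d) := (ℝ ∙ ω)ᗮ

/-- The point with parameter `t` on the line in direction `ω` through `z`. -/
noncomputable def linePoint {d : ℕ} (ω : Space d) (z : Perp ω) (t : ℝ) : Space d :=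
  (z : Space d) + t • ω

variable {d : ℕ} {ω : Space d}

lemma inner_perp (z : Perp ω) : ⟪ω, (z : Space d)⟫ = 0 :=
  Submodule.mem_orthogonal_singleton_iff_inner_right.1 z.2

lemma continuous_linePoint (z : Perp ω) : Continuous (linePoint ω z) := by
  unfold linePoint; fun_prop

lemma linePoint_add (z : Perp ω) (t s : ℝ) :
    linePoint ω z (t + s) = linePoint ω z t + s • ω := by
  simp only [linePoint, add_smul, add_assoc]

/-- Points of space correspond to pairs (line in direction `ω`, parameter on the line). -/
noncomputable def lineEquiv (hω : ‖ω‖ = 1) : Perp ω × ℝ ≃ᵐ Space d :=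
  MeasurableEquiv.prodComm.trans
    (((LinearIsometryEquiv.toSpanUnitSingleton (𝕜 := ℝ) ω hω).toMeasurableEquiv.prodCongr
      (MeasurableEquiv.refl _)).trans ((ℝ ∙ ω).measurableEquivProd (0 : Space d)).symm)

lemma lineEquiv_apply (hω : ‖ω‖ = 1) (p : Perp ω × ℝ) :
    lineEquiv hω p = linePoint ω p.1 p.2 := by
  obtain ⟨z, t⟩ := p
  simp only [lineEquiv, MeasurableEquiv.trans_apply]
  erw [Submodule.measurableEquivProd_symm_apply]
  simp only [vadd_eq_add, add_zero, linePoint]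
  rw [add_comm]
  rfl

lemma measurePreserving_lineEquiv (hω : ‖ω‖ = 1) : MeasurePreserving (lineEquiv hω) := by
  have h1 : MeasurePreserving (MeasurableEquiv.prodComm : Perp ω × ℝ ≃ᵐ ℝ × Perp ω) :=
    Measure.measurePreserving_swap
  have h2 : MeasurePreserving
      ((LinearIsometryEquiv.toSpanUnitSingleton (𝕜 := ℝ) ω hω).toMeasurableEquiv.prodCongr
      (MeasurableEquiv.refl (Perp ω))) :=
    (LinearIsometryEquiv.measurePreserving
      (LinearIsometryEquiv.toSpanUnitSingleton (𝕜 := ℝ) ω hω)).prod (MeasurePreserving.id _)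
  have h3 := ((ℝ ∙ ω).measurePreserving_measurableEquivProd (0 : Space d)).symm
  rw [InnerProductSpace.euclideanHausdorffMeasure_eq_volume] at h3
  exact h3.comp (h2.comp h1)

lemma lintegral_lines (hω : ‖ω‖ = 1) {G : Space d → ENNReal} (hG : Measurable G) :
    ∫⁻ x, G x = ∫⁻ z : Perp ω, ∫⁻ t : ℝ, G (linePoint ω z t) := by
  rw [← (measurePreserving_lineEquiv hω).lintegral_comp hG, Measure.volume_eq_prod,
    lintegral_prod (fun p => G (lineEquiv hω p))
      (hG.comp (lineEquiv hω).measurable).aemeasurable]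
  simp only [lineEquiv_apply]

/-- The intersection of the hyperplane `⟪n, x⟫ = c` with the line through `z` in direction `ω`, if
the two are transversal (otherwise the value is `z`). -/
noncomputable def lift (ω n : Space d) (c : ℝ) (z : Perp ω) : Space d :=
  linePoint ω z ((c - ⟪n, (z : Space d)⟫) / ⟪n, ω⟫)

lemma inner_linePoint (n : Space d) (z : Perp ω) (t : ℝ) :
    ⟪n, linePoint ω z t⟫ = ⟪n, (z : Space d)⟫ + t * ⟪n, ω⟫ := by
  simp [linePoint, inner_add_right, inner_smul_right]

lemma lift_eq_linePoint {n : Space d} (h : ⟪n, ω⟫ ≠ 0) {c : ℝ} {z : Perp ω} {t : ℝ}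
    (ht : ⟪n, linePoint ω z t⟫ = c) : lift ω n c z = linePoint ω z t := by
  rw [inner_linePoint] at ht
  rw [lift, ← ht]; congr 1; field_simp; ring

lemma continuous_lift (n : Space d) (c : ℝ) : Continuous (lift ω n c) := by
  unfold lift linePoint
  fun_prop

lemma injective_lift (hω : ‖ω‖ = 1) (n : Space d) (c : ℝ) : Function.Injective (lift ω n c) := by
  intro z z' h
  have h1 := (lineEquiv hω).injective (a₁ := (z, _)) (a₂ := (z', _))
    (by rw [lineEquiv_apply, lineEquiv_apply]; exact h)
  exact congrArg Prod.fst h1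

lemma measurableEmbedding_lift (hω : ‖ω‖ = 1) (n : Space d) (c : ℝ) :
    MeasurableEmbedding (lift ω n c) :=
  (continuous_lift n c).measurableEmbedding (injective_lift hω n c)

lemma isometry_linePoint (n : Space d) (c : ℝ) :
    Isometry (fun y : Perp n => linePoint n y c) := by
  refine Isometry.of_dist_eq fun x y => ?_
  simp only [linePoint, dist_add_right]
  rfl

/-- Surface measure on a hyperplane is the Lebesgue measure of an orthonormal parametrization. -/
lemma surfaceMeasure_hyperplane {n : Space d} (hn : ‖n‖ = 1) (c : ℝ) :
    (surfaceMeasure d).restrict {x | ⟪n, x⟫ = c} =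
      Measure.map (fun y : Perp n => linePoint n y c) volume := by
  have hiso := isometry_linePoint n c
  have hfin : Module.finrank ℝ (Perp n) = d - 1 := by
    have h0 : n ≠ 0 := by rintro rfl; simp at hn
    have : _ + Module.finrank ℝ (Perp n) = _ := (ℝ ∙ n).finrank_add_finrank_orthogonal
    rw [finrank_span_singleton h0, finrank_euclideanSpace_fin] at this
    omega
  have hrange : Set.range (fun y : Perp n => linePoint n y c) = {x | ⟪n, x⟫ = c} := by
    ext x
    constructor
    · rintro ⟨y, rfl⟩
      simp [inner_linePoint, inner_perp, hn]
    · intro hx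
      refine ⟨⟨x - c • n, ?_⟩, ?_⟩
      · rw [Submodule.mem_orthogonal_singleton_iff_inner_right, inner_sub_right, inner_smul_right,
          real_inner_self_eq_norm_sq, hn, hx]
        ring
      · simp [linePoint]
  rw [← InnerProductSpace.euclideanHausdorffMeasure_eq_volume, hfin,
    hiso.map_euclideanHausdorffMeasure, hrange, surfaceMeasure]

/-- Projecting a piece of the hyperplane `⟪n, x⟫ = c` along `ω` scales its area by `|⟪n, ω⟫|`. Both
sides are computed from the volume of the cylinder with that piece as base and `ω` as side. -/
theorem map_lift_volume (hω : ‖ω‖ = 1) {n : Space d} (hn : ‖n‖ = 1) (h : ⟪n, ω⟫ ≠ 0) (c : ℝ) :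
    Measure.map (lift ω n c) volume =
      ENNReal.ofReal |⟪n, ω⟫| • (surfaceMeasure d).restrict {x | ⟪n, x⟫ = c} := by
  rw [surfaceMeasure_hyperplane hn]
  have hφ : Measurable (fun y : Perp n => linePoint n y c) := by
    unfold linePoint; fun_prop
  ext A hA
  set β := ⟪n, ω⟫ with hβ
  rw [Measure.map_apply (continuous_lift n c).measurable hA, Measure.smul_apply,
    Measure.map_apply hφ hA, smul_eq_mul]
  -- `τ x` is the signed distance along `ω` from the hyperplane to `x`, and `G` is the indicator of
  -- the cylinder.
  set τ : Space d → ℝ := fun x => (⟪n, x⟫ - c) / β with hτ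
  set I : ℝ → ENNReal := (Icc (0 : ℝ) 1).indicator 1 with hI
  have hIm : Measurable I := measurable_one.indicator measurableSet_Icc
  have hAm : Measurable (A.indicator (1 : Space d → ENNReal)) := measurable_one.indicator hA
  set G : Space d → ENNReal := fun x => A.indicator 1 (x - τ x • ω) * I (τ x) with hG
  have hτm : Measurable τ := by fun_prop
  have hGm : Measurable G := by
    refine (hAm.comp ?_).mul (hIm.comp hτm)
    fun_prop
  have hI1 : ∫⁻ t, I t = 1 := by
    rw [hI, lintegral_indicator_one measurableSet_Icc]; simp
  have e1 : ∫⁻ x, G x = volume (lift ω n c ⁻¹' A) := by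
    rw [lintegral_lines hω hGm, ← lintegral_indicator_one ((continuous_lift n c).measurable hA)]
    refine lintegral_congr fun z => ?_
    have hτz : ∀ t, τ (linePoint ω z t) = t - (c - ⟪n, (z : Space d)⟫) / β := by
      intro t
      simp only [hτ, inner_linePoint]
      field_simp
      ring
    have hGz : ∀ t, G (linePoint ω z t)
        = A.indicator 1 (lift ω n c z) * I (t - (c - ⟪n, (z : Space d)⟫) / β) := by
      intro t
      simp only [hG, hτz]
      congr 2
      simp only [lift, linePoint, ← hβ, sub_smul]
      abel
    simp only [hGz]
    rw [lintegral_const_mul _ (by fun_prop), lintegral_sub_right_eq_self I, hI1, mul_one]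
    rfl
  have e2 : ∫⁻ x, G x =
      ENNReal.ofReal |β| * volume ((fun y : Perp n => linePoint n y c) ⁻¹' A) := by
    rw [lintegral_lines hn hGm]
    -- On the slice at height `s` over the hyperplane, the cylinder is its base shifted by a
    -- multiple of `q`, hence has the area of the base.
    have hq : n - β⁻¹ • ω ∈ Perp n := by
      rw [Submodule.mem_orthogonal_singleton_iff_inner_right, inner_sub_right, inner_smul_right,
        real_inner_self_eq_norm_sq, hn, ← hβ]
      field_simp
      ring
    set q : Perp n := ⟨_, hq⟩
    have hGy : ∀ (y : Perp n) (s : ℝ), G (linePoint n y s)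
        = A.indicator 1 (linePoint n (y + (s - c) • q) c) * I (β⁻¹ * (s - c)) := by
      intro y s
      have h1 : τ (linePoint n y s) = β⁻¹ * (s - c) := by
        simp only [hτ, inner_linePoint, inner_perp, real_inner_self_eq_norm_sq, hn]
        field_simp
        ring
      simp only [hG, h1]
      congr 2
      simp only [linePoint, q, Submodule.coe_add, Submodule.coe_smul]
      module
    simp only [hGy]
    have hjm : Measurable (fun p : Perp n × ℝ =>
        A.indicator (1 : Space d → ENNReal) (linePoint n (p.1 + (p.2 - c) • q) c)
          * I (β⁻¹ * (p.2 - c))) := by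
      refine (hAm.comp ?_).mul (hIm.comp ?_)
      · unfold linePoint; fun_prop
      · fun_prop
    rw [lintegral_lintegral_swap hjm.aemeasurable]
    have h3 : ∀ s : ℝ, ∫⁻ y : Perp n, A.indicator (1 : Space d → ENNReal)
        (linePoint n (y + (s - c) • q) c) * I (β⁻¹ * (s - c))
        = volume ((fun y : Perp n => linePoint n y c) ⁻¹' A) * I (β⁻¹ * (s - c)) := by
      intro s
      rw [lintegral_mul_const, lintegral_add_right_eq_self
        (fun y : Perp n => A.indicator (1 : Space d → ENNReal) (linePoint n y c))]
      · congr 1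
        rw [← lintegral_indicator_one (hφ hA)]
        rfl
      · refine hAm.comp ?_
        unfold linePoint; fun_prop
    simp only [h3]
    rw [lintegral_const_mul _ (by fun_prop), mul_comm]
    congr 1
    rw [lintegral_sub_right_eq_self (fun s => I (β⁻¹ * s))]
    have h4 : (fun s => I (β⁻¹ * s)) = ((fun s => β⁻¹ * s) ⁻¹' Icc 0 1).indicator 1 := rfl
    rw [h4, lintegral_indicator_one ((measurable_const_mul _) measurableSet_Icc),
      Real.volume_preimage_mul_left (inv_ne_zero h)]
    simp
  rw [← e1, e2]

end

/-! ### Lines through convex polytopes -/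

section

variable {d : ℕ} {ω : Space d} {K : Set (Space d)}

lemma isOpen_halfSpaces (H : Finset (Space d × ℝ)) :
    IsOpen {x : Space d | ∀ p ∈ H, ⟪p.1, x⟫ < p.2} := by
  simp only [ofPred_forall]
  exact isOpen_biInter_finset fun p _ => isOpen_lt (by fun_prop) continuous_const

lemma IsConvexPolytope.isOpen (hK : IsConvexPolytope K) : IsOpen K := by
  obtain ⟨-, -, H, rfl⟩ := hK
  exact isOpen_halfSpaces H

lemma IsConvexPolytope.convex (hK : IsConvexPolytope K) : Convex ℝ K := by
  obtain ⟨-, -, H, rfl⟩ := hK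
  simp only [ofPred_forall]
  exact convex_iInter₂ fun p _ => convex_halfSpace_lt (innerSL ℝ p.1).toLinearMap.isLinear p.2

/-- The parameters at which the line through `z` in direction `ω` is in `K`. -/
def lineTimes (ω : Space d) (K : Set (Space d)) (z : Perp ω) : Set ℝ := {t | linePoint ω z t ∈ K}

/-- The parameter at which the line through `z` enters `K`; it is `0` for a line missing `K`. -/
noncomputable def entry (ω : Space d) (K : Set (Space d)) (z : Perp ω) : ℝ :=
  sInf (lineTimes ω K z)

/-- The parameter at which the line through `z` leaves `K`; it is `0` for a line missing `K`. -/
noncomputable def exit (ω : Space d) (K : Set (Space d)) (z : Perp ω) : ℝ :=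
  sSup (lineTimes ω K z)

/-- The lines in direction `ω` that meet `K`. -/
def hitSet (ω : Space d) (K : Set (Space d)) : Set (Perp ω) := {z | (lineTimes ω K z).Nonempty}

lemma isBounded_lineTimes (hω : ‖ω‖ = 1) (hK : Bornology.IsBounded K) (z : Perp ω) :
    Bornology.IsBounded (lineTimes ω K z) := by
  have hiso : Isometry (linePoint ω z) := by
    refine Isometry.of_dist_eq fun s t => ?_
    simp only [linePoint, dist_add_left]
    rw [dist_eq_norm, ← sub_smul, norm_smul, hω, mul_one, Real.dist_eq, Real.norm_eq_abs]
  exact hiso.antilipschitz.isBounded_preimage hK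

lemma lineTimes_eq_Ioo (hω : ‖ω‖ = 1) (hK : IsConvexPolytope K) {z : Perp ω} (hz : z ∈ hitSet ω K) :
    lineTimes ω K z = Ioo (entry ω K z) (exit ω K z) := by
  have hb := isBounded_lineTimes hω hK.2.1 z
  have ho : IsOpen (lineTimes ω K z) := hK.isOpen.preimage (continuous_linePoint z)
  have hc : Convex ℝ (lineTimes ω K z) := by
    intro s hs t ht a b ha hb hab
    have := hK.convex hs ht ha hb hab
    have e : a • linePoint ω z s + b • linePoint ω z t = linePoint ω z (a • s + b • t) := by
      have hz : (z : Space d) = (a + b) • (z : Space d) := by rw [hab, one_smul]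
      simp only [linePoint, smul_eq_mul]
      conv_rhs => rw [hz]
      module
    rw [e] at this
    exact this
  refine Subset.antisymm (fun t ht => ?_) (
    IsConnected.Ioo_csInf_csSup_subset ⟨hz, hc.isPreconnected⟩ hb.bddBelow hb.bddAbove)
  obtain ⟨ε, hε, h⟩ := Metric.isOpen_iff.1 ho t ht
  have h1 : t - ε / 2 ∈ lineTimes ω K z := h (by
    rw [Metric.mem_ball, Real.dist_eq, abs_lt]; constructor <;> linarith)
  have h2 : t + ε / 2 ∈ lineTimes ω K z := h (by
    rw [Metric.mem_ball, Real.dist_eq, abs_lt]; constructor <;> linarith)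
  have h3 := csInf_le hb.bddBelow h1
  have h4 := le_csSup hb.bddAbove h2
  constructor
  · change sInf _ < t
    linarith
  · change t < sSup _
    linarith

lemma entry_lt_exit (hω : ‖ω‖ = 1) (hK : IsConvexPolytope K) {z : Perp ω} (hz : z ∈ hitSet ω K) :
    entry ω K z < exit ω K z := by
  have := hz
  rw [hitSet, mem_ofPred, lineTimes_eq_Ioo hω hK hz, nonempty_Ioo] at this
  exact this

lemma eventually_mem_after_entry (hω : ‖ω‖ = 1) (hK : IsConvexPolytope K) {z : Perp ω}
    (hz : z ∈ hitSet ω K) :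
    ∀ᶠ s in 𝓝[>] (0 : ℝ), linePoint ω z (entry ω K z) + s • ω ∈ K := by
  have h := entry_lt_exit hω hK hz
  filter_upwards [Ioo_mem_nhdsGT (sub_pos.2 h)] with s hs
  rw [← linePoint_add]
  change _ ∈ lineTimes ω K z
  rw [lineTimes_eq_Ioo hω hK hz]
  constructor <;> linarith [hs.1, hs.2]

lemma entry_notMem (hω : ‖ω‖ = 1) (hK : IsConvexPolytope K) {z : Perp ω}
    (hz : z ∈ hitSet ω K) : linePoint ω z (entry ω K z) ∉ K := by
  intro h
  change _ ∈ lineTimes ω K z at h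
  rw [lineTimes_eq_Ioo hω hK hz] at h
  exact lt_irrefl _ h.1

lemma tendsto_add_smul (x v : Space d) :
    Tendsto (fun s : ℝ => x + s • v) (𝓝[>] 0) (𝓝 x) := by
  have : Continuous (fun s : ℝ => x + s • v) := by fun_prop
  have h := this.tendsto 0
  simp only [zero_smul, add_zero] at h
  exact h.mono_left nhdsWithin_le_nhds

lemma entry_mem_closure (hω : ‖ω‖ = 1) (hK : IsConvexPolytope K) {z : Perp ω}
    (hz : z ∈ hitSet ω K) : linePoint ω z (entry ω K z) ∈ closure K :=
  mem_closure_of_tendsto (tendsto_add_smul _ ω) (eventually_mem_after_entry hω hK hz)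

/-- A line that is outside `K` at parameter `t` and inside shortly afterwards enters `K` at `t`. -/
lemma entry_eq (hω : ‖ω‖ = 1) (hK : IsConvexPolytope K) {z : Perp ω} {t : ℝ}
    (h0 : linePoint ω z t ∉ K) (h : ∀ᶠ s in 𝓝[>] (0 : ℝ), linePoint ω z t + s • ω ∈ K) :
    z ∈ hitSet ω K ∧ entry ω K z = t := by
  have hz : z ∈ hitSet ω K := by
    obtain ⟨s, hs⟩ := h.exists
    exact ⟨t + s, by rw [← linePoint_add] at hs; exact hs⟩
  refine ⟨hz, ?_⟩
  have hT := lineTimes_eq_Ioo hω hK hz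
  have h1 : ∀ᶠ s in 𝓝[>] (0 : ℝ), t + s ∈ Ioo (entry ω K z) (exit ω K z) := by
    filter_upwards [h] with s hs
    rw [← linePoint_add] at hs
    rw [← hT]; exact hs
  have h2 : t ∉ Ioo (entry ω K z) (exit ω K z) := by rw [← hT]; exact h0
  have ht : Tendsto (fun s : ℝ => t + s) (𝓝[>] 0) (𝓝 t) := by
    have hc : Continuous fun s : ℝ => t + s := by fun_prop
    exact (hc.tendsto' 0 t (by simp)).mono_left nhdsWithin_le_nhds
  have h3 : entry ω K z ≤ t := ge_of_tendsto ht (h1.mono fun s hs => hs.1.le)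
  obtain ⟨s, hs, hs0⟩ := (h1.and self_mem_nhdsWithin).exists
  by_contra hne
  exact h2 ⟨lt_of_le_of_ne h3 hne, by linarith [hs.2, show 0 < s from hs0]⟩

/-- A line that is outside `K` at parameter `t` and inside shortly before leaves `K` at `t`. -/
lemma exit_eq (hω : ‖ω‖ = 1) (hK : IsConvexPolytope K) {z : Perp ω} {t : ℝ}
    (h0 : linePoint ω z t ∉ K) (h : ∀ᶠ s in 𝓝[>] (0 : ℝ), linePoint ω z t + s • (-ω) ∈ K) :
    z ∈ hitSet ω K ∧ exit ω K z = t := by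
  have hneg : ∀ s : ℝ, linePoint ω z t + s • (-ω) = linePoint ω z (t - s) := by
    intro s
    rw [sub_eq_add_neg, linePoint_add, smul_neg, neg_smul]
  simp only [hneg] at h
  have hz : z ∈ hitSet ω K := by
    obtain ⟨s, hs⟩ := h.exists
    exact ⟨t - s, hs⟩
  refine ⟨hz, ?_⟩
  have hT := lineTimes_eq_Ioo hω hK hz
  have h1 : ∀ᶠ s in 𝓝[>] (0 : ℝ), t - s ∈ Ioo (entry ω K z) (exit ω K z) := by
    filter_upwards [h] with s hs
    rw [← hT]; exact hs
  have h2 : t ∉ Ioo (entry ω K z) (exit ω K z) := by rw [← hT]; exact h0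
  have ht : Tendsto (fun s : ℝ => t - s) (𝓝[>] 0) (𝓝 t) := by
    have hc : Continuous fun s : ℝ => t - s := by fun_prop
    exact (hc.tendsto' 0 t (by simp)).mono_left nhdsWithin_le_nhds
  have h3 : t ≤ exit ω K z := le_of_tendsto ht (h1.mono fun s hs => hs.2.le)
  obtain ⟨s, hs, hs0⟩ := (h1.and self_mem_nhdsWithin).exists
  by_contra hne
  exact h2 ⟨by linarith [hs.1, show 0 < s from hs0], lt_of_le_of_ne h3 (Ne.symm hne)⟩

lemma isOpen_hitSet (hK : IsOpen K) : IsOpen (hitSet ω K) := by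
  have : hitSet ω K = ⋃ t : ℝ, (fun z : Perp ω => linePoint ω z t) ⁻¹' K := by
    ext z; simp [hitSet, lineTimes, Set.Nonempty]
  rw [this]
  refine isOpen_iUnion fun t => hK.preimage ?_
  unfold linePoint; fun_prop

/-- A line is generic for a family of hyperplanes `⟪p.1, x⟫ = p.2` if it meets only those of them
that are transversal to it, and never two different ones in the same point. -/
def IsGeneric (ω : Space d) (H : Finset (Space d × ℝ)) (z : Perp ω) : Prop :=
  ∀ p ∈ H, ∀ q ∈ H, p.1 ≠ 0 → q.1 ≠ 0 → ∀ t, ⟪p.1, linePoint ω z t⟫ = p.2 →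
    ⟪q.1, linePoint ω z t⟫ = q.2 → ⟪p.1, ω⟫ ≠ 0 ∧ ∃ c : ℝ, q = c • p

lemma ae_inner_ne {r : Space d} (hr : r ≠ 0) (hrω : ⟪ω, r⟫ = 0) (s : ℝ) :
    ∀ᵐ z : Perp ω, ⟪r, (z : Space d)⟫ ≠ s := by
  let A : AffineSubspace ℝ (Perp ω) :=
    { carrier := {z | ⟪r, (z : Space d)⟫ = s}
      smul_vsub_vadd_mem' := by
        intro c x y z hx hy hz
        simp only [mem_ofPred_eq] at hx hy hz ⊢
        simp [inner_add_right, inner_smul_right, inner_sub_right, hx, hy, hz] }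
  have hA : A ≠ ⊤ := by
    intro h
    have h0 : (0 : Perp ω) ∈ A := by rw [h]; trivial
    have h1 : (⟨r, Submodule.mem_orthogonal_singleton_iff_inner_right.2 hrω⟩ : Perp ω) ∈ A := by
      rw [h]; trivial
    change ⟪r, ((0 : Perp ω) : Space d)⟫ = s at h0
    change ⟪r, r⟫ = s at h1
    rw [← h0] at h1
    simp at h1
    exact hr h1
  have := Measure.addHaar_affineSubspace volume A hA
  rw [ae_iff]
  convert this using 2
  ext z
  simp only [mem_ofPred_eq, not_not]
  rfl

/-- Two different hyperplanes transversal to `ω` intersect in a set which projects along `ω` into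
a proper affine subspace, hence almost every line is generic. -/
theorem ae_isGeneric (H : Finset (Space d × ℝ)) : ∀ᵐ z : Perp ω, IsGeneric ω H z := by
  unfold IsGeneric
  rw [Filter.eventually_all_finset]
  intro p _
  rw [Filter.eventually_all_finset]
  intro q _
  by_cases hp : ⟪p.1, ω⟫ = 0
  · by_cases hp0 : p.1 = 0
    · exact Eventually.of_forall fun z h => absurd hp0 h
    filter_upwards [ae_inner_ne hp0 (by rw [real_inner_comm]; exact hp) p.2] with z hz _ _ t ht _
    rw [inner_linePoint, hp, mul_zero, add_zero] at ht
    exact absurd ht hz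
  -- At a common point `r` below satisfies `⟪r, z⟫ = s`, by elimination of the parameter `t`.
  set r : Space d := ⟪q.1, ω⟫ • p.1 - ⟪p.1, ω⟫ • q.1 with hr
  set s : ℝ := ⟪q.1, ω⟫ * p.2 - ⟪p.1, ω⟫ * q.2 with hs
  have key : ∀ (z : Perp ω) (t : ℝ), ⟪p.1, linePoint ω z t⟫ = p.2 →
      ⟪q.1, linePoint ω z t⟫ = q.2 → ⟪r, (z : Space d)⟫ = s := by
    intro z t h1 h2
    rw [inner_linePoint] at h1 h2
    rw [hr, hs, inner_sub_left, inner_smul_left, inner_smul_left, ← h1, ← h2]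
    simp only [conj_trivial]
    ring
  by_cases hr0 : r = 0
  · refine Eventually.of_forall fun z _ _ t h1 h2 => ⟨hp, ⟪q.1, ω⟫ / ⟪p.1, ω⟫, ?_⟩
    have h3 := key z t h1 h2
    rw [hr0, inner_zero_left] at h3
    ext1
    · have h4 : ⟪p.1, ω⟫ • q.1 = ⟪q.1, ω⟫ • p.1 := by
        rw [← sub_eq_zero.1 (hr.symm.trans hr0)]
      rw [Prod.smul_fst, div_eq_inv_mul, mul_smul, ← h4, smul_smul, inv_mul_cancel₀ hp, one_smul]
    · rw [Prod.smul_snd, smul_eq_mul]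
      field_simp
      linarith
  · have hrω : ⟪ω, r⟫ = 0 := by
      rw [hr, inner_sub_right, inner_smul_right, inner_smul_right, real_inner_comm p.1 ω,
        real_inner_comm q.1 ω]
      ring
    filter_upwards [ae_inner_ne hr0 hrω s] with z hz _ _ t h1 h2
    exact absurd (key z t h1 h2) hz

/-- Where a generic line meets the boundary of a polytope, the polytope is locally a half space. -/
lemma exists_local_halfSpace {H F : Finset (Space d × ℝ)} (hF : F ⊆ H)
    (hK : K = {x | ∀ p ∈ F, ⟪p.1, x⟫ < p.2}) (hne : K.Nonempty) {z : Perp ω}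
    (hz : IsGeneric ω H z) {t : ℝ} (hcl : linePoint ω z t ∈ closure K)
    (hnot : linePoint ω z t ∉ K) :
    ∃ p ∈ F, p.1 ≠ 0 ∧ ⟪p.1, linePoint ω z t⟫ = p.2 ∧ ⟪p.1, ω⟫ ≠ 0 ∧
      ∀ᶠ y in 𝓝 (linePoint ω z t), (y ∈ K ↔ ⟪p.1, y⟫ < p.2) := by
  obtain ⟨x₀, hx₀⟩ := hne
  have hle : ∀ p ∈ F, ⟪p.1, linePoint ω z t⟫ ≤ p.2 := by
    intro p hp
    have hc : IsClosed {x : Space d | ⟪p.1, x⟫ ≤ p.2} :=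
      isClosed_le (by fun_prop) continuous_const
    refine closure_minimal ?_ hc hcl
    intro x hx
    rw [hK] at hx
    exact (hx p hp).le
  have hx₀' := hx₀
  rw [hK] at hnot hx₀'
  simp only [mem_ofPred_eq, not_forall, not_lt] at hnot hx₀'
  obtain ⟨p, hp, hp2⟩ := hnot
  have hpe : ⟪p.1, linePoint ω z t⟫ = p.2 := le_antisymm (hle p hp) hp2
  have active_ne : ∀ q ∈ F, ⟪q.1, linePoint ω z t⟫ = q.2 → q.1 ≠ 0 := by
    intro q hq hqe h0
    have := hx₀' q hq
    rw [h0, inner_zero_left] at this hqe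
    linarith
  have hp0 := active_ne p hp hpe
  refine ⟨p, hp, hp0, hpe, (hz p (hF hp) p (hF hp) hp0 hp0 t hpe hpe).1, ?_⟩
  have hall : ∀ᶠ y in 𝓝 (linePoint ω z t), ∀ q ∈ F, ⟪p.1, y⟫ < p.2 → ⟪q.1, y⟫ < q.2 := by
    rw [Filter.eventually_all_finset]
    intro q hq
    rcases (hle q hq).lt_or_eq with hlt | heq
    · have hc : Continuous fun y : Space d => ⟪q.1, y⟫ := by fun_prop
      filter_upwards [hc.continuousAt.eventually_lt continuousAt_const hlt] with y hy _ using hy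
    · -- `q` defines the same hyperplane as `p`, and `c > 0` since `K` has points on the inner side.
      obtain ⟨c, rfl⟩ :=
        (hz p (hF hp) q (hF hq) hp0 (active_ne q hq heq) t hpe heq).2
      have h1 := hx₀' p hp
      have h2 := hx₀' _ hq
      simp only [Prod.smul_fst, Prod.smul_snd, inner_smul_left, conj_trivial, smul_eq_mul] at h2 ⊢
      have hc : 0 < c := by
        by_contra hc
        nlinarith
      exact Eventually.of_forall fun y hy => mul_lt_mul_of_pos_left hy hc
  filter_upwards [hall] with y hy
  rw [hK]
  exact ⟨fun h => h p hp, fun h q hq => hy q hq h⟩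

end

/-! ### Integrals over the inflow boundary -/

section

variable {d : ℕ} {ω : Space d} {K : Set (Space d)}

lemma outerNormal_eq {x n : Space d} (h : IsOuterNormal K x n) : outerNormal K x = n := by
  have hex : ∃ n, IsOuterNormal K x n := ⟨n, h⟩
  rw [outerNormal, dif_pos hex]
  exact hex.choose_spec.unique h

lemma IsOuterNormal.notMem {x n : Space d} (h : IsOuterNormal K x n) : x ∉ K := by
  intro hx
  have := h.2.self_of_nhds.1 hx
  simp at this

lemma IsOuterNormal.eventually_mem {x n v : Space d} (h : IsOuterNormal K x n) (hv : ⟪n, v⟫ < 0) :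
    ∀ᶠ s in 𝓝[>] (0 : ℝ), x + s • v ∈ K := by
  filter_upwards [(tendsto_add_smul x v).eventually h.2, self_mem_nhdsWithin] with s hs hs0
  rw [hs, add_sub_cancel_left, inner_smul_right]
  exact mul_neg_of_pos_of_neg hs0 hv

lemma IsOuterNormal.mem_frontier {x n : Space d} (h : IsOuterNormal K x n) : x ∈ frontier K := by
  have hn : ⟪n, -n⟫ < 0 := by
    rw [inner_neg_right, real_inner_self_eq_norm_sq, h.1]; norm_num
  refine ⟨mem_closure_of_tendsto (tendsto_add_smul x (-n)) (h.eventually_mem hn), fun hx => ?_⟩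
  exact h.notMem (interior_subset hx)

/-- A transversal line through a boundary point with an outer normal enters `K` there. -/
lemma IsOuterNormal.entry_eq (hω : ‖ω‖ = 1) (hK : IsConvexPolytope K) {z : Perp ω} {t : ℝ}
    {n : Space d} (h : IsOuterNormal K (linePoint ω z t) n) (hn : ⟪n, ω⟫ < 0) :
    z ∈ hitSet ω K ∧ entry ω K z = t :=
  DODSD.entry_eq hω hK h.notMem (h.eventually_mem hn)

/-- The part of the hyperplane `⟪n, x⟫ = c` on which `n` is the outer normal of `K`. -/
def facePiece (K : Set (Space d)) (n : Space d) (c : ℝ) : Set (Space d) :=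
  {x | ⟪n, x⟫ = c} ∩ interior {y | y ∈ K ↔ ⟪n, y⟫ < c}

lemma measurableSet_facePiece (n : Space d) (c : ℝ) : MeasurableSet (facePiece K n c) :=
  (measurableSet_eq_fun (by fun_prop) measurable_const).inter isOpen_interior.measurableSet

lemma mem_facePiece {n : Space d} (hn : ‖n‖ = 1) {c : ℝ} {x : Space d} :
    x ∈ facePiece K n c ↔ ⟪n, x⟫ = c ∧ IsOuterNormal K x n := by
  rw [facePiece, mem_inter_iff, mem_interior_iff_mem_nhds]
  constructor
  · rintro ⟨h1, h2⟩
    refine ⟨h1, hn, ?_⟩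
    filter_upwards [h2] with y hy
    rw [inner_sub_right, sub_neg, show ⟪n, x⟫ = c from h1]
    exact hy
  · rintro ⟨h1, -, h2⟩
    refine ⟨h1, ?_⟩
    filter_upwards [h2] with y hy
    rw [inner_sub_right, sub_neg, h1] at hy
    exact hy

open Classical in
/-- The unit normals `n` and offsets `c` of those constraints `⟪n, x⟫ < c` of a polytope that bound
it on the side where lines in direction `ω` come in. -/
noncomputable def inflowFaces (ω : Space d) (F : Finset (Space d × ℝ)) : Finset (Space d × ℝ) :=
  (F.image fun p => ‖p.1‖⁻¹ • p).filter fun p => ‖p.1‖ = 1 ∧ ⟪p.1, ω⟫ < 0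

lemma mem_inflowFaces {F : Finset (Space d × ℝ)} {p : Space d × ℝ} (hp : p ∈ F) (h0 : p.1 ≠ 0)
    (h : ⟪p.1, ω⟫ < 0) : ‖p.1‖⁻¹ • p ∈ inflowFaces ω F := by
  classical
  have hpos : 0 < ‖p.1‖ := norm_pos_iff.2 h0
  rw [inflowFaces, Finset.mem_filter, Finset.mem_image]
  refine ⟨⟨p, hp, rfl⟩, ?_, ?_⟩
  · rw [Prod.smul_fst, norm_smul, norm_inv, norm_norm, inv_mul_cancel₀ hpos.ne']
  · rw [Prod.smul_fst, inner_smul_left]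
    exact mul_neg_of_pos_of_neg (by simpa using h0) h

lemma norm_of_mem_inflowFaces {F : Finset (Space d × ℝ)} {p : Space d × ℝ}
    (hp : p ∈ inflowFaces ω F) : ‖p.1‖ = 1 := by
  classical
  exact (Finset.mem_filter.1 hp).2.1

lemma inner_of_mem_inflowFaces {F : Finset (Space d × ℝ)} {p : Space d × ℝ}
    (hp : p ∈ inflowFaces ω F) : ⟪p.1, ω⟫ < 0 := by
  classical
  exact (Finset.mem_filter.1 hp).2.2

/-- If a polytope is locally a half space, then one of its constraints defines that half space. -/
lemma IsOuterNormal.exists_constraint {F : Finset (Space d × ℝ)}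
    (hK : K = {x | ∀ p ∈ F, ⟪p.1, x⟫ < p.2}) {x n : Space d} (h : IsOuterNormal K x n) :
    ∃ p ∈ F, p.1 ≠ 0 ∧ n = ‖p.1‖⁻¹ • p.1 ∧ ⟪n, x⟫ = ‖p.1‖⁻¹ * p.2 := by
  have hnn : ⟪n, n⟫ = 1 := by rw [real_inner_self_eq_norm_sq, h.1]; norm_num
  have hx := h.notMem
  have hcl := frontier_subset_closure h.mem_frontier
  rw [hK] at hx
  simp only [mem_ofPred_eq, not_forall, not_lt] at hx
  obtain ⟨p, hp, hp2⟩ := hx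
  have hpe : ⟪p.1, x⟫ = p.2 := by
    refine le_antisymm ?_ hp2
    have hc : IsClosed {x : Space d | ⟪p.1, x⟫ ≤ p.2} := isClosed_le (by fun_prop) continuous_const
    refine closure_minimal ?_ hc hcl
    intro y hy
    rw [hK] at hy
    exact (hy p hp).le
  have hneg : ∀ v, ⟪n, v⟫ < 0 → ⟪p.1, v⟫ < 0 := by
    intro v hv
    obtain ⟨s, hs, hs0⟩ := ((h.eventually_mem hv).and self_mem_nhdsWithin).exists
    rw [hK] at hs
    have h1 := hs p hp
    rw [inner_add_right, inner_smul_right, hpe] at h1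
    have hs0 : 0 < s := hs0
    by_contra hcon
    nlinarith
  set l := ⟪n, p.1⟫ with hl
  have hlpos : 0 < l := by
    have := hneg (-n) (by rw [inner_neg_right, hnn]; norm_num)
    rw [inner_neg_right, real_inner_comm, ← hl] at this
    linarith
  set q := p.1 - l • n with hq
  have hnq : ⟪n, q⟫ = 0 := by rw [hq, inner_sub_right, inner_smul_right, hnn, ← hl]; ring
  have hpq : p.1 = l • n + q := by rw [hq]; abel
  have hq0 : q = 0 := by
    by_contra hne
    have hqpos : 0 < ⟪q, q⟫ := real_inner_self_pos.2 hne
    -- The direction `q - ε n` points into `K`, while `⟪p.1, q - ε n⟫ = ‖q‖² - ε l`.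
    have h1 := hneg (-(⟪q, q⟫ / (2 * l)) • n + q) (by
      rw [inner_add_right, inner_smul_right, hnn, hnq, mul_one, add_zero, neg_lt_zero]
      positivity)
    rw [hpq, inner_add_left, inner_add_right, inner_add_right, inner_smul_left, inner_smul_left,
      inner_smul_right, inner_smul_right, hnn, hnq,
      show ⟪q, n⟫ = 0 by rw [real_inner_comm]; exact hnq] at h1
    simp only [conj_trivial, mul_one, mul_zero, add_zero, zero_add] at h1
    have h2 : l * -(⟪q, q⟫ / (2 * l)) = -(⟪q, q⟫ / 2) := by field_simp
    rw [h2] at h1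
    linarith
  have hp1 : p.1 = l • n := by rw [hpq, hq0, add_zero]
  have hnorm : ‖p.1‖ = l := by rw [hp1, norm_smul, h.1, mul_one, Real.norm_of_nonneg hlpos.le]
  have hne : n = ‖p.1‖⁻¹ • p.1 := by
    rw [hnorm, hp1, smul_smul, inv_mul_cancel₀ hlpos.ne', one_smul]
  refine ⟨p, hp, ?_, hne, ?_⟩
  · rw [← norm_pos_iff, hnorm]; exact hlpos
  · rw [← hpe]
    conv_lhs => rw [hne]
    rw [inner_smul_left]
    rfl

lemma inflowBoundary_eq_biUnion {F : Finset (Space d × ℝ)}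
    (hK : K = {x | ∀ p ∈ F, ⟪p.1, x⟫ < p.2}) :
    inflowBoundary ω K = ⋃ p ∈ inflowFaces ω F, facePiece K p.1 p.2 := by
  ext x
  rw [mem_iUnion₂]
  constructor
  · rintro ⟨-, hx⟩
    have hex : ∃ n, IsOuterNormal K x n := by
      by_contra hno
      rw [outerNormal, dif_neg hno, inner_zero_right] at hx
      exact lt_irrefl _ hx
    obtain ⟨n, hn⟩ := hex
    rw [outerNormal_eq hn] at hx
    obtain ⟨p, hp, hp0, h1, h2⟩ := hn.exists_constraint hK
    have hpω : ⟪p.1, ω⟫ < 0 := by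
      rw [h1, inner_smul_right, real_inner_comm] at hx
      have : 0 < ‖p.1‖⁻¹ := inv_pos.2 (norm_pos_iff.2 hp0)
      by_contra hcon
      nlinarith
    have hm := mem_inflowFaces hp hp0 hpω
    refine ⟨_, hm, ?_⟩
    rw [mem_facePiece (norm_of_mem_inflowFaces hm)]
    rw [Prod.smul_fst, Prod.smul_snd, ← h1]
    exact ⟨h2, hn⟩
  · rintro ⟨p, hp, hx⟩
    have h := ((mem_facePiece (norm_of_mem_inflowFaces hp)).1 hx).2
    refine ⟨h.mem_frontier, ?_⟩
    rw [outerNormal_eq h, real_inner_comm]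
    exact inner_of_mem_inflowFaces hp

/-- Almost every line that meets `K` enters it through the inflow boundary. -/
lemma ae_exists_inflowFace (hω : ‖ω‖ = 1) (hKp : IsConvexPolytope K) {F : Finset (Space d × ℝ)}
    (hK : K = {x | ∀ p ∈ F, ⟪p.1, x⟫ < p.2}) :
    ∀ᵐ z : Perp ω, z ∈ hitSet ω K →
      ∃ p ∈ inflowFaces ω F, linePoint ω z (entry ω K z) ∈ facePiece K p.1 p.2 := by
  filter_upwards [ae_isGeneric (ω := ω) F] with z hz hhit
  obtain ⟨p, hp, hp0, hpe, -, hloc⟩ := exists_local_halfSpace (Finset.Subset.refl F) hK hKp.1 hz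
    (entry_mem_closure hω hKp hhit) (entry_notMem hω hKp hhit)
  have hpω : ⟪p.1, ω⟫ < 0 := by
    obtain ⟨s, ⟨h1, h2⟩, hs0⟩ := (((tendsto_add_smul _ ω).eventually hloc).and
      (eventually_mem_after_entry hω hKp hhit) |>.and self_mem_nhdsWithin).exists
    have h3 := h1.1 h2
    rw [inner_add_right, inner_smul_right, hpe] at h3
    have hs0 : 0 < s := hs0
    by_contra hcon
    nlinarith
  have hm := mem_inflowFaces hp hp0 hpω
  refine ⟨_, hm, ?_⟩
  have hpos : 0 < ‖p.1‖⁻¹ := inv_pos.2 (norm_pos_iff.2 hp0)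
  rw [mem_facePiece (norm_of_mem_inflowFaces hm)]
  refine ⟨?_, norm_of_mem_inflowFaces hm, ?_⟩
  · simp only [Prod.smul_fst, Prod.smul_snd, inner_smul_left, hpe]; rfl
  · filter_upwards [hloc] with y hy
    rw [hy, Prod.smul_fst, inner_smul_left, inner_sub_right, hpe]
    simp only [conj_trivial]
    constructor
    · intro h; exact mul_neg_of_pos_of_neg hpos (by linarith)
    · intro h; by_contra hcon; nlinarith

lemma map_lift_volume_restrict {n : Space d} {c : ℝ} {s : Set (Space d)}
    (hs : s ⊆ {x | ⟪n, x⟫ = c}) (hsm : MeasurableSet s) (hω : ‖ω‖ = 1) (hn : ‖n‖ = 1)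
    (h : ⟪n, ω⟫ ≠ 0) :
    (Measure.map (lift ω n c) volume).restrict s =
      ENNReal.ofReal |⟪n, ω⟫| • (surfaceMeasure d).restrict s := by
  rw [map_lift_volume hω hn h, Measure.restrict_smul, Measure.restrict_restrict hsm,
    inter_eq_left.2 hs]

/-- Integrals over one inflow face, weighted by `|ω · n|`, are integrals over the lines that enter
through this face. -/
lemma setIntegral_facePiece (hω : ‖ω‖ = 1) (hKp : IsConvexPolytope K) {n : Space d} {c : ℝ}
    (hn : ‖n‖ = 1) (h : ⟪n, ω⟫ < 0) (f : Space d → ℝ) :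
    (∫ x in facePiece K n c, f x * |⟪ω, outerNormal K x⟫| ∂(surfaceMeasure d)) =
      ∫ z in lift ω n c ⁻¹' facePiece K n c, f (linePoint ω z (entry ω K z)) ∧
    (IntegrableOn (fun x => f x * |⟪ω, outerNormal K x⟫|) (facePiece K n c) (surfaceMeasure d) ↔
      IntegrableOn (fun z => f (linePoint ω z (entry ω K z)))
        (lift ω n c ⁻¹' facePiece K n c)) := by
  have hS := measurableSet_facePiece (K := K) n c
  have hemb := measurableEmbedding_lift hω n c
  have hSL : MeasurableSet (lift ω n c ⁻¹' facePiece K n c) := hemb.measurable hS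
  have e1 : EqOn (fun x => f x * |⟪ω, outerNormal K x⟫|) (fun x => f x * |⟪n, ω⟫|)
      (facePiece K n c) := by
    intro x hx
    simp only [outerNormal_eq ((mem_facePiece hn).1 hx).2, real_inner_comm]
  have e2 : EqOn (fun z => f (lift ω n c z)) (fun z => f (linePoint ω z (entry ω K z)))
      (lift ω n c ⁻¹' facePiece K n c) := by
    intro z hz
    have h1 := ((mem_facePiece hn).1 hz).2
    simp only
    rw [(h1.entry_eq hω hKp h).2]
    rfl
  have hmeas := map_lift_volume_restrict (ω := ω) (s := facePiece K n c) inter_subset_left hS hω hn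
    h.ne
  have habs : 0 < |⟪n, ω⟫| := abs_pos.2 h.ne
  constructor
  · rw [setIntegral_congr_fun hS e1, ← setIntegral_congr_fun hSL e2, integral_mul_const]
    have := hemb.setIntegral_map (μ := volume) f (facePiece K n c)
    rw [hmeas, integral_smul_measure, ENNReal.toReal_ofReal habs.le, smul_eq_mul] at this
    rw [← this, mul_comm]
  · rw [integrableOn_congr_fun e1 hS, ← integrableOn_congr_fun e2 hSL]
    have h2 := hemb.integrableOn_map_iff (μ := volume) (f := f) (s := facePiece K n c)
    rw [IntegrableOn, hmeas, integrable_smul_measure (by simpa using habs) (by simp)] at h2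
    change _ ↔ IntegrableOn (f ∘ lift ω n c) _ _
    rw [← h2, IntegrableOn, integrable_mul_const_iff (isUnit_iff_ne_zero.2 habs.ne')]

lemma inflowFace_unique {F : Finset (Space d × ℝ)} {p q : Space d × ℝ}
    (hp : p ∈ inflowFaces ω F) (hq : q ∈ inflowFaces ω F) {x : Space d}
    (h1 : x ∈ facePiece K p.1 p.2) (h2 : x ∈ facePiece K q.1 q.2) : p = q := by
  have h1 := (mem_facePiece (norm_of_mem_inflowFaces hp)).1 h1
  have h2 := (mem_facePiece (norm_of_mem_inflowFaces hq)).1 h2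
  have h3 := h1.2.unique h2.2
  refine Prod.ext h3 ?_
  rw [← h1.1, ← h2.1, h3]

/-- Integrals over the inflow boundary, weighted by `|ω · n|`, are integrals over the lines meeting
`K` of the values at the entry points. -/
theorem setIntegral_inflowBoundary (hω : ‖ω‖ = 1) (hKp : IsConvexPolytope K) {f : Space d → ℝ}
    (hf : IntegrableOn (fun x => f x * |⟪ω, outerNormal K x⟫|) (inflowBoundary ω K)
      (surfaceMeasure d)) :
    (∫ x in inflowBoundary ω K, f x * |⟪ω, outerNormal K x⟫| ∂(surfaceMeasure d)) =
      ∫ z in hitSet ω K, f (linePoint ω z (entry ω K z)) ∧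
    IntegrableOn (fun z => f (linePoint ω z (entry ω K z))) (hitSet ω K) := by
  obtain ⟨F, hK⟩ := hKp.2.2
  have hB := inflowBoundary_eq_biUnion (ω := ω) hK
  have hae : hitSet ω K =ᵐ[volume]
      ⋃ p ∈ inflowFaces ω F, lift ω p.1 p.2 ⁻¹' facePiece K p.1 p.2 := by
    filter_upwards [ae_exists_inflowFace hω hKp hK] with z hz
    apply propext
    change z ∈ hitSet ω K ↔ z ∈ ⋃ p ∈ inflowFaces ω F, lift ω p.1 p.2 ⁻¹' facePiece K p.1 p.2
    rw [mem_iUnion₂]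
    constructor
    · intro hhit
      obtain ⟨p, hp, hx⟩ := hz hhit
      refine ⟨p, hp, ?_⟩
      rw [mem_preimage, lift_eq_linePoint (inner_of_mem_inflowFaces hp).ne hx.1]
      exact hx
    · rintro ⟨p, hp, hx⟩
      exact (((mem_facePiece (norm_of_mem_inflowFaces hp)).1 hx).2.entry_eq hω hKp
        (inner_of_mem_inflowFaces hp)).1
  have hmS : ∀ p ∈ inflowFaces ω F, MeasurableSet (facePiece K p.1 p.2) :=
    fun p _ => measurableSet_facePiece _ _
  have hmL : ∀ p ∈ inflowFaces ω F, MeasurableSet (lift ω p.1 p.2 ⁻¹' facePiece K p.1 p.2) :=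
    fun p hp => (measurableEmbedding_lift hω _ _).measurable (hmS p hp)
  have hdS : Set.Pairwise (inflowFaces ω F : Set (Space d × ℝ))
      (Function.onFun Disjoint fun p : Space d × ℝ => facePiece K p.1 p.2) := by
    intro p hp q hq hpq
    exact Set.disjoint_left.2 fun x h1 h2 => hpq (inflowFace_unique hp hq h1 h2)
  have hdL : Set.Pairwise (inflowFaces ω F : Set (Space d × ℝ))
      (Function.onFun Disjoint fun p : Space d × ℝ => lift ω p.1 p.2 ⁻¹' facePiece K p.1 p.2) := by
    intro p hp q hq hpq
    refine Set.disjoint_left.2 fun z h1 h2 => hpq (inflowFace_unique hp hq h1 ?_)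
    have e1 := (((mem_facePiece (norm_of_mem_inflowFaces hp)).1 h1).2.entry_eq hω hKp
      (inner_of_mem_inflowFaces hp)).2
    have e2 := (((mem_facePiece (norm_of_mem_inflowFaces hq)).1 h2).2.entry_eq hω hKp
      (inner_of_mem_inflowFaces hq)).2
    rw [mem_preimage, lift, ← e2, e1] at h2
    exact h2
  rw [hB, integrableOn_finset_iUnion] at hf
  have hiL : ∀ p ∈ inflowFaces ω F, IntegrableOn (fun z => f (linePoint ω z (entry ω K z)))
      (lift ω p.1 p.2 ⁻¹' facePiece K p.1 p.2) := fun p hp =>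
    ((setIntegral_facePiece hω hKp (norm_of_mem_inflowFaces hp)
      (inner_of_mem_inflowFaces hp) f).2).1 (hf p hp)
  constructor
  · rw [hB, integral_biUnion_finset _ hmS hdS hf, setIntegral_congr_set hae,
      integral_biUnion_finset _ hmL hdL hiL]
    exact Finset.sum_congr rfl fun p hp => (setIntegral_facePiece hω hKp
      (norm_of_mem_inflowFaces hp) (inner_of_mem_inflowFaces hp) f).1
  · rw [integrableOn_congr_set_ae hae, integrableOn_finset_iUnion]
    exact hiL

end

/-! ### Piecewise polynomials: linearity, integrability and integration along lines -/

section

variable {d k : ℕ} {X : Set (Space d)} {T : Mesh X} {ω : Space d}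

lemma Mesh.polytope (T : Mesh X) (K : T.elements) : IsConvexPolytope (K : Set (Space d)) :=
  T.isConvexPolytope K K.2

lemma val_add (u v : ScalarSpace T k) (K : T.elements) (x : Space d) :
    val (u + v) K x = val u K x + val v K x := by simp [val]

lemma val_smul (c : ℝ) (u : ScalarSpace T k) (K : T.elements) (x : Space d) :
    val (c • u) K x = c * val u K x := by simp [val, MvPolynomial.smul_eval]

lemma dirDeriv_add (u v : ScalarSpace T k) (K : T.elements) (x : Space d) :
    dirDeriv ω (u + v) K x = dirDeriv ω u K x + dirDeriv ω v K x := by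
  simp [dirDeriv, mul_add, Finset.sum_add_distrib]

lemma dirDeriv_smul (c : ℝ) (u : ScalarSpace T k) (K : T.elements) (x : Space d) :
    dirDeriv ω (c • u) K x = c * dirDeriv ω u K x := by
  simp [dirDeriv, MvPolynomial.smul_eval, Finset.mul_sum, mul_left_comm]

lemma upstream_add (u v : ScalarSpace T k) (K : T.elements) (x : Space d) :
    upstream (u + v) K x = upstream u K x + upstream v K x := by
  classical
  simp only [upstream, val_add]
  split_ifs
  · simp
  · rw [← Finset.sum_add_distrib]
    exact Finset.sum_congr rfl fun K' _ => by split_ifs <;> simp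

lemma upstream_smul (c : ℝ) (u : ScalarSpace T k) (K : T.elements) (x : Space d) :
    upstream (c • u) K x = c * upstream u K x := by
  classical
  simp only [upstream, val_smul]
  split_ifs
  · simp
  · rw [Finset.mul_sum]
    exact Finset.sum_congr rfl fun K' _ => by split_ifs <;> simp

lemma jump_add (u v : ScalarSpace T k) (K : T.elements) (x : Space d) :
    jump (u + v) K x = jump u K x + jump v K x := by
  simp only [jump, val_add, upstream_add]; ring

lemma jump_smul (c : ℝ) (u : ScalarSpace T k) (K : T.elements) (x : Space d) :
    jump (c • u) K x = c * jump u K x := by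
  simp only [jump, val_smul, upstream_smul]; ring

lemma continuous_eval_coord (p : MvPolynomial (Fin d) ℝ) :
    Continuous fun x : Space d => MvPolynomial.eval (fun i => x i) p :=
  (MvPolynomial.continuous_eval p).comp (by fun_prop)

lemma continuous_val (u : ScalarSpace T k) (K : T.elements) : Continuous (val u K) :=
  continuous_eval_coord _

lemma continuous_dirDeriv (u : ScalarSpace T k) (K : T.elements) :
    Continuous (dirDeriv ω u K) :=
  continuous_finsetSum _ fun _ _ => continuous_const.mul (continuous_eval_coord _)

lemma measurable_upstream (u : ScalarSpace T k) (K : T.elements) : Measurable (upstream u K) := by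
  classical
  unfold upstream
  refine Measurable.ite isClosed_frontier.measurableSet measurable_const ?_
  refine Finset.measurable_fun_sum _ fun K' _ => ?_
  by_cases h : K' = K
  · simp [h]
  · simp only [ne_eq, h, not_false_eq_true, true_and]
    exact Measurable.ite isClosed_closure.measurableSet (continuous_val u K').measurable
      measurable_const

lemma measurable_jump (u : ScalarSpace T k) (K : T.elements) : Measurable (jump u K) :=
  (continuous_val u K).measurable.sub (measurable_upstream u K)

lemma exists_bound_of_continuous {s : Set (Space d)} (hs : Bornology.IsBounded s) {f : Space d → ℝ}
    (hf : Continuous f) : ∃ C, ∀ x ∈ closure s, |f x| ≤ C :=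
  hs.isCompact_closure.exists_bound_of_continuousOn hf.continuousOn

lemma exists_bound_jump {s : Set (Space d)} (hs : Bornology.IsBounded s)
    (u : ScalarSpace T k) (K : T.elements) : ∃ C, ∀ x ∈ closure s, |jump u K x| ≤ C := by
  classical
  choose C hC using fun K' : T.elements => exists_bound_of_continuous hs (continuous_val u K')
  refine ⟨C K + ∑ K', C K', fun x hx => ?_⟩
  have h0 : ∀ K', 0 ≤ C K' := fun K' => (abs_nonneg _).trans (hC K' x hx)
  have hup : |upstream u K x| ≤ ∑ K', C K' := by
    unfold upstream
    split_ifs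
    · rw [abs_zero]; exact Finset.sum_nonneg fun K' _ => h0 K'
    · refine (Finset.abs_sum_le_sum_abs _ _).trans (Finset.sum_le_sum fun K' _ => ?_)
      split_ifs
      · exact hC K' x hx
      · rw [abs_zero]; exact h0 K'
  exact (abs_sub _ _).trans (add_le_add (hC K x hx) hup)

lemma surfaceMeasure_lt_top {n : Space d} (hn : ‖n‖ = 1) {c : ℝ} {s : Set (Space d)}
    (hs : s ⊆ {x | ⟪n, x⟫ = c}) (hb : Bornology.IsBounded s) : surfaceMeasure d s < ⊤ := by
  have hiso := isometry_linePoint n c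
  have hcl : MeasurableSet {x : Space d | ⟪n, x⟫ = c} :=
    measurableSet_eq_fun (by fun_prop) measurable_const
  have hb' : Bornology.IsBounded (closure s) := hb.closure
  calc surfaceMeasure d s ≤ surfaceMeasure d (closure s ∩ {x | ⟪n, x⟫ = c}) :=
        measure_mono (subset_inter subset_closure hs)
    _ = (surfaceMeasure d).restrict {x | ⟪n, x⟫ = c} (closure s) :=
        (Measure.restrict_apply isClosed_closure.measurableSet).symm
    _ < ⊤ := by
        rw [surfaceMeasure_hyperplane hn,
          Measure.map_apply hiso.continuous.measurable isClosed_closure.measurableSet]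
        exact (hiso.antilipschitz.isBounded_preimage hb').measure_lt_top

/-- Bounded measurable functions are integrable over the inflow boundary. -/
lemma integrableOn_inflowBoundary {K : Set (Space d)} (hKp : IsConvexPolytope K)
    {f : Space d → ℝ} (hf : Measurable f) {C : ℝ} (hC : ∀ x ∈ closure K, |f x| ≤ C) :
    IntegrableOn (fun x => f x * |⟪ω, outerNormal K x⟫|) (inflowBoundary ω K)
      (surfaceMeasure d) := by
  obtain ⟨F, hK⟩ := hKp.2.2
  rw [inflowBoundary_eq_biUnion hK, integrableOn_finset_iUnion]
  intro p hp
  have hn := norm_of_mem_inflowFaces hp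
  have hm := measurableSet_facePiece (K := K) p.1 p.2
  have hsub : facePiece K p.1 p.2 ⊆ closure K := fun x hx =>
    frontier_subset_closure ((mem_facePiece hn).1 hx).2.mem_frontier
  have hcongr : EqOn (fun x => f x * |⟪ω, outerNormal K x⟫|) (fun x => f x * |⟪ω, p.1⟫|)
      (facePiece K p.1 p.2) := by
    intro x hx
    simp only [outerNormal_eq ((mem_facePiece hn).1 hx).2]
  rw [integrableOn_congr_fun hcongr hm]
  refine Integrable.mul_const ?_ _
  refine Measure.integrableOn_of_bounded (M := C)
    (surfaceMeasure_lt_top hn inter_subset_left (hKp.2.1.closure.subset hsub)).ne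
    hf.aestronglyMeasurable ?_
  exact (ae_restrict_iff' hm).2 (Eventually.of_forall fun x hx => hC x (hsub hx))

lemma integrableOn_jump_mul_val (ω : Space d) (u v : ScalarSpace T k) (K : T.elements) :
    IntegrableOn (fun x => jump u K x * val v K x * |⟪ω, outerNormal (K : Set (Space d)) x⟫|)
      (inflowBoundary ω (K : Set (Space d))) (surfaceMeasure d) := by
  have hK := T.polytope K
  obtain ⟨C₁, h₁⟩ := exists_bound_jump hK.2.1 u K
  obtain ⟨C₂, h₂⟩ := exists_bound_of_continuous hK.2.1 (continuous_val v K)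
  refine integrableOn_inflowBoundary (f := fun x => jump u K x * val v K x) (C := C₁ * C₂) hK
    ((measurable_jump u K).mul (continuous_val v K).measurable) fun x hx => ?_
  rw [abs_mul]
  exact mul_le_mul (h₁ x hx) (h₂ x hx) (abs_nonneg _) ((abs_nonneg _).trans (h₁ x hx))

lemma hasDerivAt_eval_linePoint (p : MvPolynomial (Fin d) ℝ) (z : Perp ω) (t : ℝ) :
    HasDerivAt (fun t => MvPolynomial.eval (fun i => linePoint ω z t i) p)
      (∑ j, ω j * MvPolynomial.eval (fun i => linePoint ω z t i) (MvPolynomial.pderiv j p)) t := by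
  classical
  induction p using MvPolynomial.induction_on with
  | C a => simpa using hasDerivAt_const t a
  | add p q hp hq =>
    simp only [map_add, mul_add, Finset.sum_add_distrib]
    exact hp.add hq
  | mul_X p i hp =>
    have hX : HasDerivAt (fun t => linePoint ω z t i) (ω i) t := by
      simpa [linePoint] using ((hasDerivAt_id t).mul_const (ω i)).const_add ((z : Space d) i)
    simp only [map_mul, MvPolynomial.eval_X]
    refine (hp.mul hX).congr_deriv ?_
    simp only [Derivation.leibniz, MvPolynomial.pderiv_X, smul_eq_mul, map_add, map_mul,
      MvPolynomial.eval_X, mul_add, Finset.sum_add_distrib, Finset.sum_mul]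
    rw [add_comm]
    congr 1
    · rw [Finset.sum_eq_single i]
      · simp [mul_comm]
      · intro j _ hj
        simp [hj.symm]
      · simp
    · exact Finset.sum_congr rfl fun j _ => by ring

lemma hasDerivAt_val_linePoint (u : ScalarSpace T k) (K : T.elements) (z : Perp ω) (t : ℝ) :
    HasDerivAt (fun t => val u K (linePoint ω z t)) (dirDeriv ω u K (linePoint ω z t)) t :=
  hasDerivAt_eval_linePoint _ z t

lemma integrableOn_of_continuous {K : Set (Space d)} (hK : Bornology.IsBounded K)
    {f : Space d → ℝ} (hf : Continuous f) : IntegrableOn f K :=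
  (hf.continuousOn.integrableOn_compact hK.isCompact_closure).mono_set subset_closure

/-- Integration over a polytope along the lines in direction `ω`. -/
lemma setIntegral_polytope_eq_lines (hω : ‖ω‖ = 1) {K : Set (Space d)} (hK : IsConvexPolytope K)
    {f : Space d → ℝ} (hf : Continuous f) :
    (∫ x in K, f x = ∫ z : Perp ω, ∫ t in entry ω K z..exit ω K z, f (linePoint ω z t)) ∧
    Integrable fun z : Perp ω => ∫ t in entry ω K z..exit ω K z, f (linePoint ω z t) := by
  have hm : MeasurableSet K := hK.isOpen.measurableSet
  have hint : Integrable (K.indicator f) := (integrable_indicator_iff hm).2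
    (integrableOn_of_continuous hK.2.1 hf)
  have hmp := measurePreserving_lineEquiv hω
  have hint2 : Integrable (fun p => K.indicator f (lineEquiv hω p))
      ((volume : Measure (Perp ω)).prod volume) :=
    (hmp.integrable_comp_emb (lineEquiv hω).measurableEmbedding).2 hint
  have hinner : ∀ z : Perp ω, ∫ t, K.indicator f (lineEquiv hω (z, t)) =
      ∫ t in entry ω K z..exit ω K z, f (linePoint ω z t) := by
    intro z
    have h1 : (fun t => K.indicator f (lineEquiv hω (z, t))) =
        (lineTimes ω K z).indicator fun t => f (linePoint ω z t) := by
      ext t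
      rw [lineEquiv_apply]
      rfl
    have hT : MeasurableSet (lineTimes ω K z) :=
      (hK.isOpen.preimage (continuous_linePoint z)).measurableSet
    rw [h1, integral_indicator hT]
    by_cases hz : z ∈ hitSet ω K
    · rw [lineTimes_eq_Ioo hω hK hz, intervalIntegral.integral_of_le (entry_lt_exit hω hK hz).le,
        integral_Ioc_eq_integral_Ioo]
    · have h0 : lineTimes ω K z = ∅ := not_nonempty_iff_eq_empty.1 hz
      -- Both endpoints are `0` for a line missing `K`.
      simp [entry, exit, h0]
  constructor
  · rw [← integral_indicator hm, ← hmp.integral_comp (lineEquiv hω).measurableEmbedding,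
      Measure.volume_eq_prod, integral_prod _ hint2]
    simp only [hinner]
  · have := hint2.integral_prod_left
    simpa only [hinner] using this

lemma setIntegral_dirDeriv_mul_val (hω : ‖ω‖ = 1) (u : ScalarSpace T k) (K : T.elements) :
    (∫ x in (K : Set (Space d)), dirDeriv ω u K x * val u K x =
      ∫ z : Perp ω, (val u K (linePoint ω z (exit ω (K : Set (Space d)) z)) ^ 2 -
        val u K (linePoint ω z (entry ω (K : Set (Space d)) z)) ^ 2) / 2) ∧
    Integrable fun z : Perp ω => (val u K (linePoint ω z (exit ω (K : Set (Space d)) z)) ^ 2 -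
        val u K (linePoint ω z (entry ω (K : Set (Space d)) z)) ^ 2) / 2 := by
  have h := setIntegral_polytope_eq_lines hω (T.polytope K)
    (f := fun x => dirDeriv ω u K x * val u K x)
    ((continuous_dirDeriv u K).mul (continuous_val u K))
  have hin : ∀ (z : Perp ω) (a b : ℝ),
      ∫ t in a..b, dirDeriv ω u K (linePoint ω z t) * val u K (linePoint ω z t) =
        (val u K (linePoint ω z b) ^ 2 - val u K (linePoint ω z a) ^ 2) / 2 := by
    intro z a b
    have hd : ∀ t ∈ uIcc a b, HasDerivAt (fun t => val u K (linePoint ω z t) ^ 2 / 2)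
        (dirDeriv ω u K (linePoint ω z t) * val u K (linePoint ω z t)) t := by
      intro t _
      refine (((hasDerivAt_val_linePoint u K z t).pow 2).div_const 2).congr_deriv ?_
      simp only [Nat.cast_ofNat, Nat.add_one_sub_one, pow_one]
      ring
    have hc : Continuous fun t =>
        dirDeriv ω u K (linePoint ω z t) * val u K (linePoint ω z t) :=
      ((continuous_dirDeriv u K).comp (continuous_linePoint z)).mul
        ((continuous_val u K).comp (continuous_linePoint z))
    rw [intervalIntegral.integral_eq_sub_of_hasDerivAt hd (hc.intervalIntegrable _ _)]
    ring
  simpa only [hin] using h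

end

/-! ### Nonnegativity of the transport terms -/

section

variable {d k : ℕ} {X : Set (Space d)} {T : Mesh X} {ω : Space d}

/-- If a generic line enters an element `K` at a point of the closure of another element `K'`, then
it comes from `K'`: near that point the two elements are the two sides of a hyperplane. -/
lemma eventually_mem_neighbor {H F F' : Finset (Space d × ℝ)} {K K' : Set (Space d)}
    (hω : ‖ω‖ = 1) (hKp : IsConvexPolytope K) (hKp' : IsConvexPolytope K')
    (hF : F ⊆ H) (hF' : F' ⊆ H) (hK : K = {x | ∀ p ∈ F, ⟪p.1, x⟫ < p.2})
    (hK' : K' = {x | ∀ p ∈ F', ⟪p.1, x⟫ < p.2}) (hdisj : Disjoint K K')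
    {z : Perp ω} (hz : IsGeneric ω H z) (hhit : z ∈ hitSet ω K)
    (hcl : linePoint ω z (entry ω K z) ∈ closure K') :
    linePoint ω z (entry ω K z) ∉ K' ∧
      ∀ᶠ s in 𝓝[>] (0 : ℝ), linePoint ω z (entry ω K z) + s • (-ω) ∈ K' := by
  set x := linePoint ω z (entry ω K z) with hx
  have hnot : x ∉ K' := by
    intro h
    obtain ⟨y, hy', hy⟩ :=
      mem_closure_iff.1 (entry_mem_closure hω hKp hhit) K' hKp'.isOpen h
    exact Set.disjoint_left.1 hdisj hy hy'
  refine ⟨hnot, ?_⟩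
  obtain ⟨p, hp, hp0, hpe, -, hploc⟩ := exists_local_halfSpace hF hK hKp.1 hz
    (entry_mem_closure hω hKp hhit) (entry_notMem hω hKp hhit)
  obtain ⟨q, hq, hq0, hqe, -, hqloc⟩ := exists_local_halfSpace hF' hK' hKp'.1 hz hcl hnot
  obtain ⟨-, c, rfl⟩ := hz p (hF hp) q (hF' hq) hp0 hq0 _ hpe hqe
  have hc0 : c ≠ 0 := by rintro rfl; simp at hq0
  -- Just after its entry the line is in `K`, hence not in `K'`; so `K'` is on the other side, that
  -- is, `c < 0`.
  obtain ⟨s, ⟨⟨h1, h2⟩, h3⟩, hs0⟩ := (((tendsto_add_smul x ω).eventually hploc).and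
    ((tendsto_add_smul x ω).eventually hqloc) |>.and
    (eventually_mem_after_entry hω hKp hhit) |>.and self_mem_nhdsWithin).exists
  have hs0 : 0 < s := hs0
  have h4 := h1.1 h3
  have h5 := (not_congr h2).1 (Set.disjoint_left.1 hdisj h3)
  simp only [Prod.smul_fst, Prod.smul_snd, inner_smul_left, conj_trivial, smul_eq_mul] at h5 hqloc
  rw [← hpe, inner_add_right, inner_smul_right] at h4 h5
  have hpω : ⟪p.1, ω⟫ < 0 := by by_contra hcon; nlinarith
  have hc : c < 0 := by
    rcases hc0.lt_or_gt with h | h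
    · exact h
    · exact absurd (mul_lt_mul_of_pos_left h4 h) h5
  filter_upwards [(tendsto_add_smul x (-ω)).eventually hqloc, self_mem_nhdsWithin] with r hr hr0
  have hr0 : 0 < r := hr0
  rw [hr, ← hpe, inner_add_right, inner_smul_right, inner_neg_right]
  have : 0 < r * (-⟪p.1, ω⟫) := mul_pos hr0 (by linarith)
  nlinarith

lemma Mesh.eq_of_mem {K K' : T.elements} {x : Space d} (h : x ∈ (K : Set (Space d)))
    (h' : x ∈ (K' : Set (Space d))) : K = K' := by
  by_contra hne
  exact Set.disjoint_left.1 (T.disjoint K K.2 K' K'.2 fun e => hne (Subtype.ext e)) h h'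

lemma sum_ite_sq_of_unique {ι : Type*} [Fintype ι] (P : ι → Prop) [DecidablePred P]
    (hP : ∀ i j, P i → P j → i = j) (f : ι → ℝ) :
    (∑ i, if P i then f i else 0) ^ 2 = ∑ i, if P i then f i ^ 2 else 0 := by
  by_cases h : ∃ i, P i
  · obtain ⟨i, hi⟩ := h
    have h1 : ∀ j ≠ i, ¬ P j := fun j hj hPj => hj (hP j i hPj hi)
    rw [Finset.sum_eq_single i, Finset.sum_eq_single i]
    · simp [hi]
    · intro j _ hj; simp [h1 j hj]
    · simp
    · intro j _ hj; simp [h1 j hj]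
    · simp
  · have h1 : ∀ i, ¬ P i := fun i hi => h ⟨i, hi⟩
    simp [h1]

open Classical in
/-- Energy balance on one line: each upstream value is zero or the exit value of the preceding
element, so that the sum over the elements is at least half the sum of the squared exit values
that are not upstream values of another element. -/
lemma line_energy_nonneg (hω : ‖ω‖ = 1) (u : ScalarSpace T k) :
    ∀ᵐ z : Perp ω, 0 ≤ ∑ K : T.elements,
      ((val u K (linePoint ω z (exit ω (K : Set (Space d)) z)) ^ 2 -
        val u K (linePoint ω z (entry ω (K : Set (Space d)) z)) ^ 2) / 2 +
      (hitSet ω (K : Set (Space d))).indicator (fun z =>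
        jump u K (linePoint ω z (entry ω (K : Set (Space d)) z)) *
          val u K (linePoint ω z (entry ω (K : Set (Space d)) z))) z) := by
  choose F hF using fun K : T.elements => (T.polytope K).2.2
  have hsub : ∀ K, F K ⊆ Finset.univ.biUnion F := fun K =>
    Finset.subset_biUnion_of_mem F (Finset.mem_univ K)
  filter_upwards [ae_isGeneric (ω := ω) (Finset.univ.biUnion F)] with z hz
  -- `K'` precedes `K` on the line through `z`.
  set R : T.elements → T.elements → Prop := fun K K' =>
    K' ≠ K ∧ linePoint ω z (entry ω (K : Set (Space d)) z) ∈ closure (K' : Set (Space d)) with hR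
  have hnb : ∀ K K' : T.elements, z ∈ hitSet ω (K : Set (Space d)) → R K K' →
      linePoint ω z (entry ω (K : Set (Space d)) z) ∉ (K' : Set (Space d)) ∧
      ∀ᶠ s in 𝓝[>] (0 : ℝ), linePoint ω z (entry ω (K : Set (Space d)) z) + s • (-ω) ∈
        (K' : Set (Space d)) := fun K K' hhit h =>
    eventually_mem_neighbor hω (T.polytope K) (T.polytope K') (hsub K) (hsub K') (hF K) (hF K')
      (T.disjoint K K.2 K' K'.2 fun e => h.1 (Subtype.ext e.symm)) hz hhit h.2
  have hexit : ∀ K K' : T.elements, z ∈ hitSet ω (K : Set (Space d)) → R K K' →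
      z ∈ hitSet ω (K' : Set (Space d)) ∧
      exit ω (K' : Set (Space d)) z = entry ω (K : Set (Space d)) z := fun K K' hhit h =>
    exit_eq hω (T.polytope K') (hnb K K' hhit h).1 (hnb K K' hhit h).2
  have hR_right : ∀ K : T.elements, z ∈ hitSet ω (K : Set (Space d)) → ∀ K₁ K₂ : T.elements,
      R K K₁ → R K K₂ → K₁ = K₂ := by
    intro K hhit K₁ K₂ h₁ h₂
    obtain ⟨s, hs₁, hs₂⟩ := ((hnb K K₁ hhit h₁).2.and (hnb K K₂ hhit h₂).2).exists
    exact Mesh.eq_of_mem hs₁ hs₂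
  have hR_left : ∀ K' K₁ K₂ : T.elements, (z ∈ hitSet ω (K₁ : Set (Space d)) ∧ R K₁ K') →
      (z ∈ hitSet ω (K₂ : Set (Space d)) ∧ R K₂ K') → K₁ = K₂ := by
    rintro K' K₁ K₂ ⟨hh₁, h₁⟩ ⟨hh₂, h₂⟩
    have h1 := eventually_mem_after_entry hω (T.polytope K₁) hh₁
    have h2 := eventually_mem_after_entry hω (T.polytope K₂) hh₂
    rw [← (hexit K₁ K' hh₁ h₁).2] at h1
    rw [← (hexit K₂ K' hh₂ h₂).2] at h2
    obtain ⟨s, hs₁, hs₂⟩ := (h1.and h2).exists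
    exact Mesh.eq_of_mem hs₁ hs₂
  -- `hR_right`, `hR_left`: predecessors are unique, and an element precedes at most one other.
  set out : T.elements → ℝ := fun K => val u K (linePoint ω z (exit ω (K : Set (Space d)) z)) ^ 2
    with hout
  have hup : ∀ K : T.elements, z ∈ hitSet ω (K : Set (Space d)) →
      upstream u K (linePoint ω z (entry ω (K : Set (Space d)) z)) ^ 2 ≤
        ∑ K', if z ∈ hitSet ω (K : Set (Space d)) ∧ R K K' then out K' else 0 := by
    intro K hhit
    unfold upstream
    split_ifs with hX
    · rw [zero_pow two_ne_zero]
      exact Finset.sum_nonneg fun K' _ => by split_ifs <;> positivity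
    · refine (sum_ite_sq_of_unique (R K) (hR_right K hhit) _).trans_le (le_of_eq ?_)
      refine Finset.sum_congr rfl fun K' _ => ?_
      by_cases h : R K K'
      · rw [if_pos h, if_pos ⟨hhit, h⟩, hout]
        simp only [(hexit K K' hhit h).2]
      · rw [if_neg h, if_neg fun h' => h h'.2]
  have hone : ∀ K', ∑ K : T.elements,
      (if z ∈ hitSet ω (K : Set (Space d)) ∧ R K K' then out K' else 0) ≤
      if z ∈ hitSet ω (K' : Set (Space d)) then out K' else 0 := by
    intro K'
    by_cases h : ∃ K : T.elements, z ∈ hitSet ω (K : Set (Space d)) ∧ R K K'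
    · obtain ⟨K, hK⟩ := h
      rw [Finset.sum_eq_single K, if_pos hK, if_pos (hexit K K' hK.1 hK.2).1]
      · intro K₂ _ hne
        exact if_neg fun h2 => hne (hR_left K' K₂ K h2 hK)
      · simp
    · have h1 : ∀ K : T.elements, ¬ (z ∈ hitSet ω (K : Set (Space d)) ∧ R K K') :=
        fun K hK => h ⟨K, hK⟩
      simp only [h1, if_false, Finset.sum_const_zero]
      split_ifs <;> positivity
  have hterm : ∀ K : T.elements,
      ((if z ∈ hitSet ω (K : Set (Space d)) then out K else 0) -
        ∑ K', if z ∈ hitSet ω (K : Set (Space d)) ∧ R K K' then out K' else 0) / 2 ≤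
      (val u K (linePoint ω z (exit ω (K : Set (Space d)) z)) ^ 2 -
        val u K (linePoint ω z (entry ω (K : Set (Space d)) z)) ^ 2) / 2 +
      (hitSet ω (K : Set (Space d))).indicator (fun z =>
        jump u K (linePoint ω z (entry ω (K : Set (Space d)) z)) *
          val u K (linePoint ω z (entry ω (K : Set (Space d)) z))) z := by
    intro K
    by_cases hhit : z ∈ hitSet ω (K : Set (Space d))
    · rw [indicator_of_mem hhit, if_pos hhit, jump]
      have h1 := hup K hhit
      have h2 := sq_nonneg (val u K (linePoint ω z (entry ω (K : Set (Space d)) z)) -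
        upstream u K (linePoint ω z (entry ω (K : Set (Space d)) z)))
      have h3 : out K = val u K (linePoint ω z (exit ω (K : Set (Space d)) z)) ^ 2 := rfl
      nlinarith
    · -- For a line missing `K`, entry and exit are both `sInf ∅ = sSup ∅ = 0`.
      have h0 : lineTimes ω (K : Set (Space d)) z = ∅ := not_nonempty_iff_eq_empty.1 hhit
      rw [indicator_of_notMem hhit]
      simp [hhit, entry, exit, h0]
  refine le_trans ?_ (Finset.sum_le_sum fun K _ => hterm K)
  rw [← Finset.sum_div, Finset.sum_sub_distrib, Finset.sum_comm]
  have := Finset.sum_le_sum fun K' (_ : K' ∈ Finset.univ) => hone K'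
  linarith

/-- The transport and jump terms of the discrete bilinear form are together nonnegative. -/
theorem transport_energy_nonneg (hω : ‖ω‖ = 1) (u : ScalarSpace T k) :
    0 ≤ (∑ K : T.elements, ∫ x in (K : Set (Space d)), dirDeriv ω u K x * val u K x) +
      ∑ K : T.elements, ∫ x in inflowBoundary ω (K : Set (Space d)),
        jump u K x * val u K x * |⟪ω, outerNormal (K : Set (Space d)) x⟫| ∂(surfaceMeasure d) := by
  classical
  have h1 := fun K : T.elements => setIntegral_dirDeriv_mul_val hω u K
  have h2 := fun K : T.elements => setIntegral_inflowBoundary hω (T.polytope K)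
    (f := fun x => jump u K x * val u K x) (integrableOn_jump_mul_val ω u u K)
  have hm : ∀ K : T.elements, MeasurableSet (hitSet ω (K : Set (Space d))) := fun K =>
    (isOpen_hitSet (T.polytope K).isOpen).measurableSet
  have h3 : ∀ K : T.elements, Integrable ((hitSet ω (K : Set (Space d))).indicator (fun z =>
        jump u K (linePoint ω z (entry ω (K : Set (Space d)) z)) *
          val u K (linePoint ω z (entry ω (K : Set (Space d)) z)))) := fun K =>
    (integrable_indicator_iff (hm K)).2 (h2 K).2
  rw [← Finset.sum_add_distrib]
  have h4 : ∀ K : T.elements, _ := fun K => integral_add (h1 K).2 (h3 K)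
  have h5 : (∑ K : T.elements, ((∫ x in (K : Set (Space d)), dirDeriv ω u K x * val u K x) +
      ∫ x in inflowBoundary ω (K : Set (Space d)),
        jump u K x * val u K x * |⟪ω, outerNormal (K : Set (Space d)) x⟫| ∂(surfaceMeasure d))) =
      ∑ K : T.elements, ∫ z : Perp ω,
        ((val u K (linePoint ω z (exit ω (K : Set (Space d)) z)) ^ 2 -
          val u K (linePoint ω z (entry ω (K : Set (Space d)) z)) ^ 2) / 2 +
        (hitSet ω (K : Set (Space d))).indicator (fun z =>
          jump u K (linePoint ω z (entry ω (K : Set (Space d)) z)) *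
            val u K (linePoint ω z (entry ω (K : Set (Space d)) z))) z) := by
    refine Finset.sum_congr rfl fun K _ => ?_
    rw [h4 K, (h1 K).1, (h2 K).1, integral_indicator (hm K)]
  have h6 : ∀ K : T.elements, Integrable fun z : Perp ω =>
      (val u K (linePoint ω z (exit ω (K : Set (Space d)) z)) ^ 2 -
          val u K (linePoint ω z (entry ω (K : Set (Space d)) z)) ^ 2) / 2 +
        (hitSet ω (K : Set (Space d))).indicator (fun z =>
          jump u K (linePoint ω z (entry ω (K : Set (Space d)) z)) *
            val u K (linePoint ω z (entry ω (K : Set (Space d)) z))) z :=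
    fun K => (h1 K).2.add (h3 K)
  rw [h5, ← integral_finsetSum _ fun K _ => h6 K]
  exact integral_nonneg_of_ae (line_energy_nonneg hω u)

end

/-! ### Linear algebra -/

section

lemma isLinearMap_sum {V ι : Type*} [AddCommGroup V] [Module ℝ V] (s : Finset ι)
    {f : ι → V → ℝ} (hf : ∀ i, IsLinearMap ℝ (f i)) : IsLinearMap ℝ fun v => ∑ i ∈ s, f i v where
  map_add u v := by simp only [(hf _).map_add, Finset.sum_add_distrib]
  map_smul c v := by simp only [(hf _).map_smul, Finset.smul_sum]

lemma isLinearMap_add {V : Type*} [AddCommGroup V] [Module ℝ V]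
    {f g : V → ℝ} (hf : IsLinearMap ℝ f) (hg : IsLinearMap ℝ g) :
    IsLinearMap ℝ fun v => f v + g v where
  map_add u v := by rw [hf.map_add, hg.map_add]; ring
  map_smul c v := by rw [hf.map_smul, hg.map_smul, smul_add]

lemma isLinearMap_const_mul {V : Type*} [AddCommGroup V] [Module ℝ V] (a : ℝ)
    {f : V → ℝ} (hf : IsLinearMap ℝ f) : IsLinearMap ℝ fun v => a * f v where
  map_add u v := by rw [hf.map_add, mul_add]
  map_smul c v := by rw [hf.map_smul, smul_eq_mul, smul_eq_mul, mul_left_comm]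

lemma isLinearMap_integral {V α : Type*} [AddCommGroup V] [Module ℝ V] [MeasurableSpace α]
    {μ : Measure α} {f : α → V → ℝ} (hf : ∀ x, IsLinearMap ℝ (f x))
    (hi : ∀ v, Integrable (fun x => f x v) μ) : IsLinearMap ℝ fun v => ∫ x, f x v ∂μ where
  map_add u v := by simp only [(hf _).map_add]; exact integral_add (hi u) (hi v)
  map_smul c v := by simp only [(hf _).map_smul]; exact integral_smul c _

/-- A bilinear form on a finite-dimensional space without nonzero isotropic vectors represents
every linear functional uniquely. -/
lemma existsUnique_of_definite {V : Type*} [AddCommGroup V] [Module ℝ V] [Module.Finite ℝ V]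
    {b : V → V → ℝ} {φ : V → ℝ} (h₁ : ∀ v, IsLinearMap ℝ fun u => b u v)
    (h₂ : ∀ u, IsLinearMap ℝ (b u)) (hφ : IsLinearMap ℝ φ) (hb : ∀ u, b u u = 0 → u = 0) :
    ∃! u, ∀ v, b u v = φ v := by
  let A : V →ₗ[ℝ] Module.Dual ℝ V := LinearMap.mk₂ ℝ b (fun u u' v => (h₁ v).map_add u u')
    (fun c u v => (h₁ v).map_smul c u) (fun u v v' => (h₂ u).map_add v v')
    (fun c u v => (h₂ u).map_smul c v)
  have hA : ∀ u v, A u v = b u v := fun _ _ => rfl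
  have hinj : Function.Injective A := by
    rw [← LinearMap.ker_eq_bot, LinearMap.ker_eq_bot']
    intro u hu
    exact hb u (by rw [← hA, hu]; rfl)
  have hsurj : Function.Surjective A :=
    (LinearMap.injective_iff_surjective_of_finrank_eq_finrank Subspace.dual_finrank_eq.symm).1 hinj
  obtain ⟨u, hu⟩ := hsurj (hφ.mk' φ)
  refine ⟨u, fun v => ?_, fun u' hu' => hinj ?_⟩
  · rw [← hA, hu]; rfl
  · ext v
    rw [hu, hA, hu' v]; rfl

/-! ### Pointwise coercivity -/

section Coercivity

variable {ι : Type*} [Fintype ι]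

/-- For a symmetric kernel the two arguments of the weighted double sum may be interchanged. -/
lemma sum_symm_kernel {w : ι → ℝ} {G : ι → ι → ℝ} (hG : ∀ i j, G i j = G j i) (x y : ι → ℝ) :
    ∑ l, w l * ∑ i, w i * G l i * (x i + y l) = ∑ l, w l * (∑ i, w i * G l i) * (x l + y l) := by
  have h : ∑ l, w l * ∑ i, w i * G l i * x i = ∑ l, w l * (∑ i, w i * G l i) * x l := by
    simp only [Finset.mul_sum, Finset.sum_mul]
    rw [Finset.sum_comm]
    refine Finset.sum_congr rfl fun i _ => Finset.sum_congr rfl fun l _ => ?_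
    rw [hG l i]; ring
  simp only [mul_add, Finset.sum_add_distrib, h]
  congr 1
  refine Finset.sum_congr rfl fun l _ => ?_
  rw [← Finset.sum_mul, mul_assoc]

/-- Pointwise coercivity, with `a l` the value and `D l` the streamline derivative of the `l`-th
component. The zeroth order terms are controlled through the symmetry of the kernel `G`; the terms
with the factor `δ` are absorbed by them and by `δ D²`. -/
lemma pointwise_coercive {w : ι → ℝ} (hw : ∀ l, 0 < w l) {G : ι → ι → ℝ}
    (hG : ∀ i j, G i j = G j i) (hG0 : ∀ i j, 0 ≤ G i j) {σt σs m M c δ : ℝ} (hσs : 0 ≤ σs)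
    (hm : ∀ l, ∑ i, w i * G l i ≤ m) (hM : |σt| ≤ M) (hm0 : 0 ≤ m) (hc : 0 < c)
    (hcm : c ≤ σt - m * σs)
    (hδ : 0 ≤ δ) (hδM : δ * (4 * M ^ 2) ≤ c) (a D : ι → ℝ) :
    c / 2 * ∑ l, w l * a l ^ 2 ≤
      ∑ l, w l * ((D l + σt * a l - σs * ∑ i, w i * G l i * a i) * (a l + δ * D l) -
        D l * a l) := by
  set r : ι → ℝ := fun l => ∑ i, w i * G l i with hr
  have hmσ : 0 ≤ m * σs := mul_nonneg hm0 hσs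
  have hσM : σt ≤ M := (le_abs_self _).trans hM
  have hM0 : 0 < M := by linarith
  have hrm : ∀ l, σs * r l ≤ m * σs := fun l => by
    rw [mul_comm m]; exact mul_le_mul_of_nonneg_left (hm l) hσs
  have hA : ∀ y : ι → ℝ, (∀ l, 0 ≤ y l) →
      ∑ l, w l * r l * y l * σs ≤ (m * σs) * ∑ l, w l * y l := by
    intro y hy
    rw [Finset.mul_sum]
    refine Finset.sum_le_sum fun l _ => ?_
    have := mul_le_mul_of_nonneg_left (hrm l) (mul_nonneg (hw l).le (hy l))
    nlinarith
  -- scattering tested with the values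
  have h1 : ∑ l, w l * ((σs * ∑ i, w i * G l i * a i) * a l) ≤ (m * σs) * ∑ l, w l * a l ^ 2 := by
    refine le_trans ?_ (hA (fun l => a l ^ 2) fun l => sq_nonneg _)
    have e := sum_symm_kernel (w := w) hG (fun i => a i ^ 2 / 2) (fun l => a l ^ 2 / 2)
    have e2 : ∑ l, w l * r l * a l ^ 2 * σs =
        (∑ l, w l * ∑ i, w i * G l i * (a i ^ 2 / 2 + a l ^ 2 / 2)) * σs := by
      rw [e, Finset.sum_mul]
      exact Finset.sum_congr rfl fun l _ => by ring
    rw [e2, Finset.sum_mul]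
    refine Finset.sum_le_sum fun l _ => ?_
    have h : (∑ i, w i * G l i * a i) * a l ≤ ∑ i, w i * G l i * (a i ^ 2 / 2 + a l ^ 2 / 2) := by
      rw [Finset.sum_mul]
      refine Finset.sum_le_sum fun i _ => ?_
      have hwG := mul_nonneg (hw i).le (hG0 l i)
      nlinarith [mul_nonneg hwG (sq_nonneg (a i - a l))]
    have := mul_le_mul_of_nonneg_left h (mul_nonneg (hw l).le hσs)
    nlinarith
  -- scattering tested with the streamline derivatives
  have h2 : ∑ l, w l * ((σs * ∑ i, w i * G l i * a i) * D l) ≤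
      M ^ 2 * ∑ l, w l * a l ^ 2 + 1 / 4 * ∑ l, w l * D l ^ 2 := by
    have e := sum_symm_kernel (w := w) hG (fun i => M * a i ^ 2) (fun l => D l ^ 2 / (4 * M))
    have h3 : ∑ l, w l * ((σs * ∑ i, w i * G l i * a i) * D l) ≤
        (∑ l, w l * ∑ i, w i * G l i * (M * a i ^ 2 + D l ^ 2 / (4 * M))) * σs := by
      rw [Finset.sum_mul]
      refine Finset.sum_le_sum fun l _ => ?_
      have h : (∑ i, w i * G l i * a i) * D l ≤
          ∑ i, w i * G l i * (M * a i ^ 2 + D l ^ 2 / (4 * M)) := by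
        rw [Finset.sum_mul]
        refine Finset.sum_le_sum fun i _ => ?_
        have hwG := mul_nonneg (hw i).le (hG0 l i)
        have hy : a i * D l ≤ M * a i ^ 2 + D l ^ 2 / (4 * M) := by
          have : M * a i ^ 2 + D l ^ 2 / (4 * M) - a i * D l
              = (2 * M * a i - D l) ^ 2 / (4 * M) := by field_simp; ring
          have : 0 ≤ (2 * M * a i - D l) ^ 2 / (4 * M) := by positivity
          linarith
        rw [mul_assoc (w i * G l i)]
        exact mul_le_mul_of_nonneg_left hy hwG
      have := mul_le_mul_of_nonneg_left h (mul_nonneg (hw l).le hσs)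
      nlinarith
    refine h3.trans ?_
    rw [e, Finset.sum_mul]
    refine (hA (fun l => M * a l ^ 2 + D l ^ 2 / (4 * M)) fun l => by positivity).trans ?_
    have hsum : ∑ l, w l * (M * a l ^ 2 + D l ^ 2 / (4 * M)) =
        M * ∑ l, w l * a l ^ 2 + 1 / (4 * M) * ∑ l, w l * D l ^ 2 := by
      rw [Finset.mul_sum, Finset.mul_sum, ← Finset.sum_add_distrib]
      exact Finset.sum_congr rfl fun l _ => by ring
    rw [hsum]
    have hS1 : 0 ≤ ∑ l, w l * a l ^ 2 :=
      Finset.sum_nonneg fun l _ => mul_nonneg (hw l).le (sq_nonneg _)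
    have hS2 : 0 ≤ ∑ l, w l * D l ^ 2 :=
      Finset.sum_nonneg fun l _ => mul_nonneg (hw l).le (sq_nonneg _)
    have hle : m * σs ≤ M := by linarith
    refine (mul_le_mul_of_nonneg_right hle (by positivity)).trans (le_of_eq ?_)
    field_simp
  -- the absorption term tested with the streamline derivatives
  have h3 : -∑ l, w l * (σt * a l * D l) ≤
      M ^ 2 * ∑ l, w l * a l ^ 2 + 1 / 4 * ∑ l, w l * D l ^ 2 := by
    rw [Finset.mul_sum, Finset.mul_sum, ← Finset.sum_add_distrib, ← Finset.sum_neg_distrib]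
    refine Finset.sum_le_sum fun l _ => ?_
    have hsq : σt ^ 2 ≤ M ^ 2 := sq_le_sq' (abs_le.1 hM).1 (abs_le.1 hM).2
    have h : -(σt * a l * D l) ≤ M ^ 2 * a l ^ 2 + 1 / 4 * D l ^ 2 := by
      nlinarith [sq_nonneg (σt * a l + D l / 2), mul_le_mul_of_nonneg_right hsq (sq_nonneg (a l))]
    have := mul_le_mul_of_nonneg_left h (hw l).le
    linarith
  have hsplit : ∑ l, w l * ((D l + σt * a l - σs * ∑ i, w i * G l i * a i) * (a l + δ * D l)
        - D l * a l) =
      σt * (∑ l, w l * a l ^ 2) - (∑ l, w l * ((σs * ∑ i, w i * G l i * a i) * a l)) +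
      δ * ((∑ l, w l * D l ^ 2) + (∑ l, w l * (σt * a l * D l)) -
        ∑ l, w l * ((σs * ∑ i, w i * G l i * a i) * D l)) := by
    rw [← Finset.sum_add_distrib, ← Finset.sum_sub_distrib, Finset.mul_sum, Finset.mul_sum,
      ← Finset.sum_sub_distrib, ← Finset.sum_add_distrib]
    exact Finset.sum_congr rfl fun l _ => by ring
  rw [hsplit]
  have hS1 : 0 ≤ ∑ l, w l * a l ^ 2 :=
    Finset.sum_nonneg fun l _ => mul_nonneg (hw l).le (sq_nonneg _)
  have hS2 : 0 ≤ ∑ l, w l * D l ^ 2 :=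
    Finset.sum_nonneg fun l _ => mul_nonneg (hw l).le (sq_nonneg _)
  have h4 : -(2 * M ^ 2 * ∑ l, w l * a l ^ 2) ≤ (∑ l, w l * D l ^ 2) +
      (∑ l, w l * (σt * a l * D l)) - ∑ l, w l * ((σs * ∑ i, w i * G l i * a i) * D l) := by
    linarith
  have h5 := mul_le_mul_of_nonneg_left h4 hδ
  have h6 := mul_le_mul_of_nonneg_right hδM hS1
  have h7 := mul_le_mul_of_nonneg_right hcm hS1
  linarith

end Coercivity

/-! ### The bilinear form of the scheme -/

variable {d k L : ℕ} {X : Set (Space d)} {T : Mesh X}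

lemma eq_zero_of_val_eq_zero {u : ScalarSpace T k} {K : T.elements}
    (h : ∀ x ∈ (K : Set (Space d)), val u K x = 0) : u K = 0 := by
  have hK := T.polytope K
  obtain ⟨x, hx⟩ := hK.1
  have ho : IsOpen ((fun y : Fin d → ℝ => (WithLp.toLp 2 y : Space d)) ⁻¹' (K : Set (Space d))) :=
    hK.isOpen.preimage (by fun_prop)
  obtain ⟨ε, hε, hb⟩ := Metric.isOpen_iff.1 ho (fun i => x i) hx
  apply Subtype.ext
  refine MvPolynomial.funext_set (fun i => Metric.ball (x i) ε) (fun i => ?_) fun y hy => ?_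
  · rw [Real.ball_eq_Ioo]
    exact Ioo_infinite (by linarith)
  · rw [← ball_pi _ hε] at hy
    have := h _ (hb hy)
    simpa [val] using this

/-- The integrand over an element of the bilinear form of the scheme. -/
noncomputable def volumeIntegrand (σt σs : Space d → ℝ) (g : Space d → ℝ → ℝ)
    (w : Fin (L + 1) → ℝ) (ω : Fin (L + 1) → Angle d) (δ : ℝ) (l : Fin (L + 1)) (K : T.elements)
    (x : Space d) (u v : VecSpace T k L) : ℝ :=
  (dirDeriv (ω l) (u l) K x + σt x * val (u l) K x -
      σs x * ∑ i, w i * g x ⟪(ω l : Space d), (ω i : Space d)⟫ * val (u i) K x) *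
    (val (v l) K x + δ * dirDeriv (ω l) (v l) K x)

/-- The bilinear form of the scheme, with the scattering term moved to the left-hand side. -/
noncomputable def bilinearForm (T : Mesh X) (σt σs : Space d → ℝ) (g : Space d → ℝ → ℝ)
    (w : Fin (L + 1) → ℝ) (ω : Fin (L + 1) → Angle d) (δ : ℝ) (u v : VecSpace T k L) : ℝ :=
  (∑ l, w l * ∑ K : T.elements, ∫ x in (K : Set (Space d)),
      volumeIntegrand σt σs g w ω δ l K x u v) +
  ∑ l, w l * ∑ K : T.elements, ∫ x in inflowBoundary (ω l : Space d) (K : Set (Space d)),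
    jump (u l) K x * (val (v l) K x * |⟪(ω l : Space d), outerNormal (K : Set (Space d)) x⟫|)
      ∂(surfaceMeasure d)

/-- The linear functional given by the source `f`. -/
noncomputable def loadForm (T : Mesh X) (f : Space d → Angle d → ℝ) (w : Fin (L + 1) → ℝ)
    (ω : Fin (L + 1) → Angle d) (δ : ℝ) (v : VecSpace T k L) : ℝ :=
  ∑ l, w l * ∑ K : T.elements, ∫ x in (K : Set (Space d)),
    f x (ω l) * (val (v l) K x + δ * dirDeriv (ω l) (v l) K x)

lemma continuous_test (η : Space d) (δ : ℝ) (v : ScalarSpace T k) (K : T.elements) :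
    Continuous fun x => val v K x + δ * dirDeriv η v K x :=
  (continuous_val v K).add (continuous_const.mul (continuous_dirDeriv v K))

lemma integrableOn_mul_continuous {c φ : Space d → ℝ} (hc : IntegrableOn c X) (hφ : Continuous φ)
    (K : T.elements) : IntegrableOn (fun x => c x * φ x) (K : Set (Space d)) := by
  obtain ⟨C, hC⟩ := exists_bound_of_continuous (T.polytope K).2.1 hφ
  refine Integrable.mul_bdd (c := C) (hc.mono_set (T.subset_domain K K.2))
    hφ.aestronglyMeasurable ?_
  exact (ae_restrict_iff' (T.polytope K).isOpen.measurableSet).2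
    (Eventually.of_forall fun x hx => hC x (subset_closure hx))

variable {σt σs : Space d → ℝ} {g : Space d → ℝ → ℝ} {w : Fin (L + 1) → ℝ}
  {ω : Fin (L + 1) → Angle d} {δ : ℝ}

lemma integrableOn_scattering
    (hs : ∀ l i, IntegrableOn (fun x => σs x * (w i * g x ⟪(ω l : Space d), (ω i : Space d)⟫)) X)
    (l : Fin (L + 1)) (K : T.elements) (u : VecSpace T k L) {φ : Space d → ℝ} (hφ : Continuous φ) :
    IntegrableOn (fun x => σs x * (∑ i, w i * g x ⟪(ω l : Space d), (ω i : Space d)⟫ *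
      val (u i) K x) * φ x) (K : Set (Space d)) := by
  have h : ∀ i, IntegrableOn (fun x => σs x * (w i * g x ⟪(ω l : Space d), (ω i : Space d)⟫) *
      (val (u i) K x * φ x)) (K : Set (Space d)) := fun i =>
    integrableOn_mul_continuous (hs l i) ((continuous_val (u i) K).mul hφ) K
  refine (integrable_finsetSum Finset.univ fun i _ => h i).congr (Eventually.of_forall fun x => ?_)
  simp only [Finset.mul_sum, Finset.sum_mul]
  exact Finset.sum_congr rfl fun i _ => by ring

lemma integrableOn_transport (ht : IntegrableOn σt X) (η : Space d) (u : ScalarSpace T k)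
    (K : T.elements) {φ : Space d → ℝ} (hφ : Continuous φ) :
    IntegrableOn (fun x => (dirDeriv η u K x + σt x * val u K x) * φ x) (K : Set (Space d)) := by
  have h1 : IntegrableOn (fun x => dirDeriv η u K x * φ x) (K : Set (Space d)) :=
    integrableOn_of_continuous (T.polytope K).2.1 ((continuous_dirDeriv u K).mul hφ)
  have h2 := integrableOn_mul_continuous ht ((continuous_val u K).mul hφ) K
  refine (h1.add h2).congr (Eventually.of_forall fun x => ?_)
  simp only [Pi.add_apply, Pi.mul_apply]
  ring

lemma integrableOn_volumeIntegrand (ht : IntegrableOn σt X)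
    (hs : ∀ l i, IntegrableOn (fun x => σs x * (w i * g x ⟪(ω l : Space d), (ω i : Space d)⟫)) X)
    (l : Fin (L + 1)) (K : T.elements) (u v : VecSpace T k L) :
    IntegrableOn (fun x => volumeIntegrand σt σs g w ω δ l K x u v) (K : Set (Space d)) := by
  have hφ := continuous_test (ω l : Space d) δ (v l) K
  refine ((integrableOn_transport ht (ω l : Space d) (u l) K hφ).sub
    (integrableOn_scattering hs l K u hφ)).congr (Eventually.of_forall fun x => ?_)
  simp only [Pi.sub_apply, volumeIntegrand]
  ring

lemma isSolution_iff {f : Space d → Angle d → ℝ} (ht : IntegrableOn σt X)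
    (hs : ∀ l i, IntegrableOn (fun x => σs x * (w i * g x ⟪(ω l : Space d), (ω i : Space d)⟫)) X)
    (hf : ∀ l, IntegrableOn (fun x => f x (ω l)) X) (u : VecSpace T k L) :
    IsSolution T σt σs g f w ω δ u ↔
      ∀ v, bilinearForm T σt σs g w ω δ u v = loadForm T f w ω δ v := by
  refine forall_congr' fun v => ?_
  have h1 : ∀ (l : Fin (L + 1)) (K : T.elements),
      ∫ x in (K : Set (Space d)), volumeIntegrand σt σs g w ω δ l K x u v =
      (∫ x in (K : Set (Space d)), (dirDeriv (ω l) (u l) K x + σt x * val (u l) K x) *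
          (val (v l) K x + δ * dirDeriv (ω l) (v l) K x)) -
      ∫ x in (K : Set (Space d)), σs x * (∑ i, w i * g x ⟪(ω l : Space d), (ω i : Space d)⟫ *
          val (u i) K x) * (val (v l) K x + δ * dirDeriv (ω l) (v l) K x) := by
    intro l K
    have hφ := continuous_test (ω l : Space d) δ (v l) K
    rw [← integral_sub (integrableOn_transport ht (ω l : Space d) (u l) K hφ)
      (integrableOn_scattering hs l K u hφ)]
    simp only [volumeIntegrand, sub_mul]
  have h2 : ∀ (l : Fin (L + 1)) (K : T.elements),
      ∫ x in (K : Set (Space d)), (σs x * (∑ i, w i * g x ⟪(ω l : Space d), (ω i : Space d)⟫ *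
          val (u i) K x) + f x (ω l)) * (val (v l) K x + δ * dirDeriv (ω l) (v l) K x) =
      (∫ x in (K : Set (Space d)), σs x * (∑ i, w i * g x ⟪(ω l : Space d), (ω i : Space d)⟫ *
          val (u i) K x) * (val (v l) K x + δ * dirDeriv (ω l) (v l) K x)) +
      ∫ x in (K : Set (Space d)), f x (ω l) *
          (val (v l) K x + δ * dirDeriv (ω l) (v l) K x) := by
    intro l K
    have hφ := continuous_test (ω l : Space d) δ (v l) K
    rw [← integral_add (integrableOn_scattering hs l K u hφ)
      (integrableOn_mul_continuous (hf l) hφ K)]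
    simp only [add_mul]
  simp only [bilinearForm, loadForm, h1, h2]
  simp only [Finset.sum_sub_distrib, Finset.sum_add_distrib, mul_add, mul_sub]
  constructor <;> intro h <;> linarith

lemma integrableOn_jump_mul (η : Space d) (u v : ScalarSpace T k) (K : T.elements) :
    IntegrableOn (fun x => jump u K x * (val v K x * |⟪η, outerNormal (K : Set (Space d)) x⟫|))
      (inflowBoundary η (K : Set (Space d))) (surfaceMeasure d) := by
  simpa only [mul_assoc] using integrableOn_jump_mul_val η u v K

lemma isLinearMap_bilinearForm_left (ht : IntegrableOn σt X)
    (hs : ∀ l i, IntegrableOn (fun x => σs x * (w i * g x ⟪(ω l : Space d), (ω i : Space d)⟫)) X)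
    (v : VecSpace T k L) : IsLinearMap ℝ fun u => bilinearForm T σt σs g w ω δ u v := by
  refine isLinearMap_add
    (isLinearMap_sum _ fun l => isLinearMap_const_mul _ (isLinearMap_sum _ fun K =>
      isLinearMap_integral (fun x => ⟨fun u u' => ?_, fun c u => ?_⟩)
        fun u => integrableOn_volumeIntegrand ht hs l K u v))
    (isLinearMap_sum _ fun l => isLinearMap_const_mul _ (isLinearMap_sum _ fun K =>
      isLinearMap_integral (fun x => ⟨fun u u' => ?_, fun c u => ?_⟩)
        fun u => integrableOn_jump_mul (ω l : Space d) (u l) (v l) K))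
  · simp only [volumeIntegrand, Pi.add_apply, val_add, dirDeriv_add, mul_add,
      Finset.sum_add_distrib]
    ring
  · simp only [volumeIntegrand, Pi.smul_apply, val_smul, dirDeriv_smul, smul_eq_mul,
      mul_left_comm _ c, ← Finset.mul_sum]
    ring
  · simp only [Pi.add_apply, jump_add]; ring
  · simp only [Pi.smul_apply, jump_smul, smul_eq_mul]; ring

lemma isLinearMap_bilinearForm_right (ht : IntegrableOn σt X)
    (hs : ∀ l i, IntegrableOn (fun x => σs x * (w i * g x ⟪(ω l : Space d), (ω i : Space d)⟫)) X)
    (u : VecSpace T k L) : IsLinearMap ℝ (bilinearForm T σt σs g w ω δ u) := by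
  refine isLinearMap_add
    (isLinearMap_sum _ fun l => isLinearMap_const_mul _ (isLinearMap_sum _ fun K =>
      isLinearMap_integral (fun x => ⟨fun v v' => ?_, fun c v => ?_⟩)
        fun v => integrableOn_volumeIntegrand ht hs l K u v))
    (isLinearMap_sum _ fun l => isLinearMap_const_mul _ (isLinearMap_sum _ fun K =>
      isLinearMap_integral (fun x => ⟨fun v v' => ?_, fun c v => ?_⟩)
        fun v => integrableOn_jump_mul (ω l : Space d) (u l) (v l) K))
  · simp only [volumeIntegrand, Pi.add_apply, val_add, dirDeriv_add]; ring
  · simp only [volumeIntegrand, Pi.smul_apply, val_smul, dirDeriv_smul, smul_eq_mul]; ring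
  · simp only [Pi.add_apply, val_add]; ring
  · simp only [Pi.smul_apply, val_smul, smul_eq_mul]; ring

lemma isLinearMap_loadForm {f : Space d → Angle d → ℝ}
    (hf : ∀ l, IntegrableOn (fun x => f x (ω l)) X) :
    IsLinearMap ℝ (loadForm (k := k) T f w ω δ) := by
  refine isLinearMap_sum _ fun l => isLinearMap_const_mul _ (isLinearMap_sum _ fun K =>
      isLinearMap_integral (fun x => ⟨fun v v' => ?_, fun c v => ?_⟩)
        fun v => integrableOn_mul_continuous (hf l) (continuous_test (ω l : Space d) δ (v l) K) K)
  · simp only [Pi.add_apply, val_add, dirDeriv_add]; ring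
  · simp only [Pi.smul_apply, val_smul, dirDeriv_smul, smul_eq_mul]; ring

lemma inner_angle_mem (η ξ : Angle d) : ⟪(η : Space d), (ξ : Space d)⟫ ∈ Icc (-1 : ℝ) 1 := by
  have h := abs_real_inner_le_norm (η : Space d) (ξ : Space d)
  rw [norm_eq_of_mem_sphere, norm_eq_of_mem_sphere, one_mul] at h
  exact abs_le.1 h

lemma le_quadMax (x : Space d) (l : Fin (L + 1)) :
    ∑ i, w i * g x ⟪(ω l : Space d), (ω i : Space d)⟫ ≤ quadMax g w ω x :=
  le_ciSup (f := fun l => ∑ i, w i * g x ⟪(ω l : Space d), (ω i : Space d)⟫)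
    (Set.finite_range _).bddAbove l

/-- Coercivity of the bilinear form for small `δ`. -/
lemma bilinearForm_self_ge (hw : ∀ l, 0 < w l) (ht : IntegrableOn σt X)
    (hs : ∀ l i, IntegrableOn (fun x => σs x * (w i * g x ⟪(ω l : Space d), (ω i : Space d)⟫)) X)
    (hσs : ∀ᵐ x ∂(volume.restrict X), 0 ≤ σs x)
    (hg : ∀ x ∈ X, ∀ t ∈ Icc (-1 : ℝ) 1, 0 ≤ g x t)
    {c M : ℝ} (hc : 0 < c) (hM : ∀ᵐ x ∂(volume.restrict X), |σt x| ≤ M)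
    (hq : ∀ᵐ x ∂(volume.restrict X), c ≤ σt x - quadMax g w ω x * σs x)
    (hδ : 0 ≤ δ) (hδM : δ * (4 * M ^ 2) ≤ c) (u : VecSpace T k L) :
    ∑ K : T.elements, ∫ x in (K : Set (Space d)), c / 2 * ∑ l, w l * val (u l) K x ^ 2 ≤
      bilinearForm T σt σs g w ω δ u u := by
  have hωn : ∀ l, ‖(ω l : Space d)‖ = 1 := fun l => norm_eq_of_mem_sphere _
  have hDa : ∀ (l : Fin (L + 1)) (K : T.elements),
      IntegrableOn (fun x => dirDeriv (ω l : Space d) (u l) K x * val (u l) K x)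
        (K : Set (Space d)) := fun l K =>
    integrableOn_of_continuous (T.polytope K).2.1
      ((continuous_dirDeriv (u l) K).mul (continuous_val (u l) K))
  have hvol := fun (l : Fin (L + 1)) (K : T.elements) =>
    integrableOn_volumeIntegrand (δ := δ) ht hs l K u u
  have hdiff : ∀ (l : Fin (L + 1)) (K : T.elements), IntegrableOn (fun x => w l *
      (volumeIntegrand σt σs g w ω δ l K x u u -
        dirDeriv (ω l : Space d) (u l) K x * val (u l) K x)) (K : Set (Space d)) := fun l K =>
    ((hvol l K).sub (hDa l K)).const_mul (w l)
  have hsplit : bilinearForm T σt σs g w ω δ u u =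
      (∑ K : T.elements, ∫ x in (K : Set (Space d)), ∑ l, w l *
        (volumeIntegrand σt σs g w ω δ l K x u u -
          dirDeriv (ω l : Space d) (u l) K x * val (u l) K x)) +
      ∑ l, w l * ((∑ K : T.elements, ∫ x in (K : Set (Space d)),
          dirDeriv (ω l : Space d) (u l) K x * val (u l) K x) +
        ∑ K : T.elements, ∫ x in inflowBoundary (ω l : Space d) (K : Set (Space d)),
          jump (u l) K x * val (u l) K x *
            |⟪(ω l : Space d), outerNormal (K : Set (Space d)) x⟫| ∂(surfaceMeasure d)) := by
    have h1 : ∀ K : T.elements, ∫ x in (K : Set (Space d)), ∑ l, w l *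
        (volumeIntegrand σt σs g w ω δ l K x u u -
          dirDeriv (ω l : Space d) (u l) K x * val (u l) K x) =
        ∑ l, w l * ((∫ x in (K : Set (Space d)), volumeIntegrand σt σs g w ω δ l K x u u) -
          ∫ x in (K : Set (Space d)), dirDeriv (ω l : Space d) (u l) K x * val (u l) K x) := by
      intro K
      rw [integral_finsetSum _ fun l _ => hdiff l K]
      refine Finset.sum_congr rfl fun l _ => ?_
      rw [integral_const_mul, integral_sub (hvol l K) (hDa l K)]
    simp only [h1, bilinearForm, ← mul_assoc]
    rw [Finset.sum_comm]
    simp only [← Finset.mul_sum, Finset.sum_sub_distrib, mul_add, mul_sub, Finset.sum_add_distrib]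
    ring
  have hpos : 0 ≤ ∑ l, w l * ((∑ K : T.elements, ∫ x in (K : Set (Space d)),
          dirDeriv (ω l : Space d) (u l) K x * val (u l) K x) +
        ∑ K : T.elements, ∫ x in inflowBoundary (ω l : Space d) (K : Set (Space d)),
          jump (u l) K x * val (u l) K x *
            |⟪(ω l : Space d), outerNormal (K : Set (Space d)) x⟫| ∂(surfaceMeasure d)) :=
    Finset.sum_nonneg fun l _ => mul_nonneg (hw l).le (transport_energy_nonneg (hωn l) (u l))
  rw [hsplit]
  refine le_add_of_le_of_nonneg (Finset.sum_le_sum fun K _ => ?_) hpos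
  have hKX := T.subset_domain K K.2
  have hKm := (T.polytope K).isOpen.measurableSet
  refine setIntegral_mono_ae_restrict ?_ ?_ ?_
  · refine integrableOn_of_continuous (T.polytope K).2.1 (continuous_const.mul ?_)
    exact continuous_finsetSum _ fun l _ => continuous_const.mul ((continuous_val (u l) K).pow 2)
  · exact integrable_finsetSum _ fun l _ => hdiff l K
  · filter_upwards [ae_restrict_of_ae_restrict_of_subset hKX hσs,
      ae_restrict_of_ae_restrict_of_subset hKX hM, ae_restrict_of_ae_restrict_of_subset hKX hq,
      ae_restrict_mem hKm] with x h1 h2 h3 hxK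
    have hG0 : ∀ i j, 0 ≤ g x ⟪(ω i : Space d), (ω j : Space d)⟫ := fun i j =>
      hg x (hKX hxK) _ (inner_angle_mem _ _)
    have hm0 : 0 ≤ quadMax g w ω x :=
      (Finset.sum_nonneg fun i _ => mul_nonneg (hw i).le (hG0 0 i)).trans (le_quadMax x 0)
    exact pointwise_coercive hw (G := fun l i => g x ⟪(ω l : Space d), (ω i : Space d)⟫)
      (fun i j => by rw [real_inner_comm]) hG0 h1 (fun l => le_quadMax x l) h2 hm0 hc h3 hδ hδM
      (fun l => val (u l) K x) (fun l => dirDeriv (ω l : Space d) (u l) K x)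

lemma eq_zero_of_integral_sq_nonpos (hw : ∀ l, 0 < w l) {c : ℝ} (hc : 0 < c) (u : VecSpace T k L)
    (h : ∑ K : T.elements, ∫ x in (K : Set (Space d)), c / 2 * ∑ l, w l * val (u l) K x ^ 2 ≤ 0) :
    u = 0 := by
  have hnn : ∀ (K : T.elements) (x : Space d), 0 ≤ c / 2 * ∑ l, w l * val (u l) K x ^ 2 :=
    fun K x => mul_nonneg (by positivity)
      (Finset.sum_nonneg fun l _ => mul_nonneg (hw l).le (sq_nonneg _))
  have hc' : ∀ K : T.elements, Continuous fun x => c / 2 * ∑ l, w l * val (u l) K x ^ 2 :=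
    fun K => continuous_const.mul (continuous_finsetSum _ fun l _ =>
      continuous_const.mul ((continuous_val (u l) K).pow 2))
  have h0 := (Finset.sum_eq_zero_iff_of_nonneg fun (K : T.elements) _ =>
    setIntegral_nonneg (μ := volume) (T.polytope K).isOpen.measurableSet fun x _ => hnn K x).1
    (le_antisymm h (Finset.sum_nonneg fun (K : T.elements) _ =>
      setIntegral_nonneg (T.polytope K).isOpen.measurableSet fun x _ => hnn K x))
  funext l K
  refine eq_zero_of_val_eq_zero fun x hx => ?_
  have h1 := (setIntegral_eq_zero_iff_of_nonneg_ae (Eventually.of_forall fun x => hnn K x)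
    (integrableOn_of_continuous (T.polytope K).2.1 (hc' K))).1 (h0 K (Finset.mem_univ K))
  have h2 := Measure.eqOn_open_of_ae_eq h1 (T.polytope K).isOpen (hc' K).continuousOn
    continuousOn_const hx
  simp only [Pi.zero_apply] at h2
  have h3 := (mul_eq_zero.1 h2).resolve_left (by positivity)
  have h4 := (Finset.sum_eq_zero_iff_of_nonneg fun l _ =>
    mul_nonneg (hw l).le (sq_nonneg _)).1 h3 l (Finset.mem_univ l)
  exact pow_eq_zero_iff two_ne_zero |>.1 ((mul_eq_zero.1 h4).resolve_left (hw l).ne')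

lemma exists_ae_bound_of_memLp_top {α : Type*} [MeasurableSpace α] {μ : Measure α} {f : α → ℝ}
    (hf : MemLp f ⊤ μ) : ∃ M, ∀ᵐ x ∂μ, |f x| ≤ M := by
  refine ⟨(eLpNorm f ⊤ μ).toReal, ?_⟩
  filter_upwards [enorm_ae_le_eLpNormEssSup f μ] with x hx
  rw [← eLpNorm_exponent_top] at hx
  have := ENNReal.toReal_mono hf.2.ne hx
  simpa using this

lemma Mesh.size_nonneg (T : Mesh X) : 0 ≤ T.size :=
  Real.iSup_nonneg fun _ => Metric.diam_nonneg

end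

end DODSD

theorem theorem4p3 {d : ℕ} (hd : d = 2 ∨ d = 3)
    (X : Set (DODSD.Space d)) (hXo : IsOpen X) (hXc : IsConnected X)
    (hXb : Bornology.IsBounded X)
    (σt σs : DODSD.Space d → ℝ)
    (hσt : MemLp σt ⊤ (volume.restrict X)) (hσs : MemLp σs ⊤ (volume.restrict X))
    (hσs0 : ∀ᵐ x ∂(volume.restrict X), 0 ≤ σs x)
    (c₀ : ℝ) (hc₀ : 0 < c₀) (hσ : ∀ᵐ x ∂(volume.restrict X), c₀ ≤ σt x - σs x)
    (g : DODSD.Space d → ℝ → ℝ)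
    (hgm : ∀ t ∈ Set.Icc (-1 : ℝ) 1, AEMeasurable (fun x => g x t) (volume.restrict X))
    (hg0 : ∀ x ∈ X, ∀ t ∈ Set.Icc (-1 : ℝ) 1, 0 ≤ g x t)
    (hg1 : ∀ x ∈ X, ∀ η : DODSD.Angle d,
      ∫ ξ : DODSD.Angle d, g x ⟪(η : DODSD.Space d), (ξ : DODSD.Space d)⟫
        ∂((volume : Measure (DODSD.Space d)).toSphere) = 1)
    (L : ℕ) (w : Fin (L + 1) → ℝ) (hw : ∀ l, 0 < w l) (ω : Fin (L + 1) → DODSD.Angle d)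
    (c₀' : ℝ) (hc₀' : 0 < c₀')
    (hquad : ∀ᵐ x ∂(volume.restrict X), c₀' ≤ σt x - DODSD.quadMax g w ω x * σs x)
    (cbar : ℝ) (hcbar : 0 < cbar) :
    ∃ h₀ : ℝ, 0 < h₀ ∧
      ∀ T : DODSD.Mesh X, T.size < h₀ → ∀ k : ℕ, 1 ≤ k →
        ∀ f : DODSD.Space d → DODSD.Angle d → ℝ,
          (∀ l, MemLp (fun x => f x (ω l)) 2 (volume.restrict X)) →
          ∃! u : DODSD.VecSpace T k L,
            DODSD.IsSolution T σt σs g f w ω (cbar * T.size) u := by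
  obtain ⟨M, hM⟩ := DODSD.exists_ae_bound_of_memLp_top hσt
  have hfin : IsFiniteMeasure (volume.restrict X) :=
    ⟨by rw [Measure.restrict_apply_univ]; exact hXb.measure_lt_top⟩
  have ht : IntegrableOn σt X := hσt.integrable le_top
  -- `g` itself may be unbounded; `hquad` bounds `σs * (w i * g)` by `m * σs ≤ σt`.
  have hs : ∀ l i, IntegrableOn (fun x => σs x *
      (w i * g x ⟪(ω l : DODSD.Space d), (ω i : DODSD.Space d)⟫)) X := by
    intro l i
    refine Integrable.of_bound (C := M) (hσs.1.mul
      (((hgm _ (DODSD.inner_angle_mem (ω l) (ω i))).const_mul (w i)).aestronglyMeasurable)) ?_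
    filter_upwards [hσs0, hM, hquad, ae_restrict_mem hXo.measurableSet] with x h1 h2 h3 hx
    have hG0 : ∀ j, 0 ≤ w j * g x ⟪(ω l : DODSD.Space d), (ω j : DODSD.Space d)⟫ := fun j =>
      mul_nonneg (hw j).le (hg0 x hx _ (DODSD.inner_angle_mem _ _))
    have h4 : w i * g x ⟪(ω l : DODSD.Space d), (ω i : DODSD.Space d)⟫ ≤ DODSD.quadMax g w ω x :=
      (Finset.single_le_sum (fun j _ => hG0 j) (Finset.mem_univ i)).trans (DODSD.le_quadMax x l)
    rw [Real.norm_of_nonneg (mul_nonneg h1 (hG0 i))]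
    have h5 := mul_le_mul_of_nonneg_left h4 h1
    linarith [(le_abs_self (σt x)).trans h2]
  -- This `h₀` gives `4 M² δ ≤ c₀'` for `δ = cbar * h`; the `+ 1` only makes the denominator
  -- positive.
  refine ⟨c₀' / (4 * cbar * (M ^ 2 + 1)), by positivity, fun T hT k _ f hf => ?_⟩
  have hfi : ∀ l, IntegrableOn (fun x => f x (ω l)) X := fun l =>
    (hf l).integrable one_le_two
  have hδ : 0 ≤ cbar * T.size := mul_nonneg hcbar.le T.size_nonneg
  have hδM : cbar * T.size * (4 * M ^ 2) ≤ c₀' := by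
    rw [lt_div_iff₀ (by positivity)] at hT
    nlinarith
  simp only [DODSD.isSolution_iff ht hs hfi]
  refine DODSD.existsUnique_of_definite (DODSD.isLinearMap_bilinearForm_left ht hs)
    (DODSD.isLinearMap_bilinearForm_right ht hs) (DODSD.isLinearMap_loadForm hfi) fun u hu => ?_
  exact DODSD.eq_zero_of_integral_sq_nonpos hw hc₀' u
    ((DODSD.bilinearForm_self_ge hw ht hs hσs0 hg0 hc₀' hM hquad hδ hδM u).trans_eq hu)
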